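/- Let $k=k_n$ be a sequence of integers with $2\le k_n\le n$ for all large $n$. In the planted clique model, $\bm H$ is a uniformly random $k$-clique in the complete graph $K_n$, $\bm G\sim G(n,p)$ is independent of $\bm H$, and one observes $\bm Y=\bm H\cup\bm G$. Identify graphs on $n$ vertices with vectors in $\{0,1\}^{\binom n2}$ and let \[ \mathsf{MMSE}_n(p)=\mathbb E\big\|\bm H-\mathbb E[\bm H\mid\bm Y]\big\|_2^2 . \] The model is said to exhibit an all-or-nothing (AoN) transition at the critical probability $p_c=p_c(n)$ if for every constant $\epsilon>0$, as $n\to\infty$, $\mathsf{MMSE}_n(p)/\binom k2\to 1$ uniformly over $p\in[0,1]$ with $p\ge(1+\epsilon)p_c(n)$, and $\mathsf{MMSE}_n(p)/\binom k2\to 0$ uniformly over $p\in[0,1]$ with $p\le(1-\epsilon)p_c(n)$. Let $p_{1\mathrm M}(n)$ be the first moment threshold, i.e. the smallest $p\in[0,1]$ for which the expected number of $k$-cliques in $G(n,p)$ is at least one. (a) If $k_n\to\infty$, then the model exhibits AoN at \[ p_{\mathrm{AoN}}=p_{1\mathrm M}(n)=\binom nk^{-1/\binom k2}, \] where the second equality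 holds for all large $n$. (b) If $k_n=O(1)$, then there is no sequence $p_c=p_c(n)$ of real numbers at which the model exhibits AoN. -/

import Mathlib

open Filter MeasureTheory

/-- The copies of `H` in the complete graph on `Fin n`, each regarded as a graph on `Fin n`
(that is, through its edge set). -/
def graphCopies {v : ℕ} (H : SimpleGraph (Fin v)) (n : ℕ) : Set (SimpleGraph (Fin n)) :=
  Set.range fun f : Fin v ↪ Fin n => H.map f

/-- The joint law of `(𝐇, 𝐆)` in the planted model: `𝐇` is a uniformly random copy of `H` and `𝐆` is
an independent binomial random graph `G(n,p)`. -/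
noncomputable def plantedLaw {v : ℕ} (H : SimpleGraph (Fin v)) (n : ℕ) (p : unitInterval) :
    Measure (SimpleGraph (Fin n) × SimpleGraph (Fin n)) :=
  (ProbabilityTheory.uniformOn (graphCopies H n)).prod (SimpleGraph.binomialRandom (Fin n) p)

/-- The observed graph `𝐘 = 𝐇 ∪ 𝐆`. -/
def observedGraph {n : ℕ} (ω : SimpleGraph (Fin n) × SimpleGraph (Fin n)) :
    SimpleGraph (Fin n) :=
  ω.1 ⊔ ω.2

/-- The coordinate at `e` of the binary vector of a graph: `1` if `e` is an edge, `0` otherwise. -/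
noncomputable def edgeCoord {n : ℕ} (A : SimpleGraph (Fin n)) (e : Sym2 (Fin n)) : ℝ :=
  A.edgeSet.indicator (fun _ => (1 : ℝ)) e

/-- The coordinate at `e` of the posterior mean `E[𝐇 | 𝐘 = y]`. The space is finite, so this is the
elementary conditional expectation given the event `𝐘 = y`; its value at outcomes `y` of
probability zero is never used. -/
noncomputable def posteriorMean {v : ℕ} (H : SimpleGraph (Fin v)) (n : ℕ) (p : unitInterval)
    (y : SimpleGraph (Fin n)) (e : Sym2 (Fin n)) : ℝ :=
  ∫ ω, edgeCoord ω.1 e ∂(ProbabilityTheory.cond (plantedLaw H n p) (observedGraph ⁻¹' {y}))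

/-- The minimum mean squared error `E ‖𝐇 - E[𝐇 | 𝐘]‖²`, where graphs on `Fin n` are identified with
binary vectors indexed by the edges of the complete graph. -/
noncomputable def plantedMMSE {v : ℕ} (H : SimpleGraph (Fin v)) (n : ℕ) (p : unitInterval) : ℝ :=
  ∫ ω, ∑ e ∈ (⊤ : SimpleGraph (Fin n)).edgeFinset,
    (edgeCoord ω.1 e - posteriorMean H n p (observedGraph ω) e) ^ 2 ∂(plantedLaw H n p)

/-- The MMSE divided by the number of edges of `H`. -/
noncomputable def normalizedMMSE {v : ℕ} (H : SimpleGraph (Fin v)) (n : ℕ) (p : unitInterval) : ℝ :=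
  plantedMMSE H n p / (H.edgeSet.ncard : ℝ)

/-- The expected number of copies of `H` contained in `G(n,p)`. -/
noncomputable def expectedCopies {v : ℕ} (H : SimpleGraph (Fin v)) (n : ℕ) (p : unitInterval) : ℝ :=
  ∫ G : SimpleGraph (Fin n), (G.copyCount H : ℝ) ∂(SimpleGraph.binomialRandom (Fin n) p)

/-- The first moment threshold: the smallest `p ∈ [0,1]` for which the expected number of copies of
`H` in `G(n,p)` is at least one. -/
noncomputable def firstMomentThreshold {v : ℕ} (H : SimpleGraph (Fin v)) (n : ℕ) : ℝ :=
  sInf {x : ℝ | ∃ p : unitInterval, (p : ℝ) = x ∧ 1 ≤ expectedCopies H n p}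

/-- All-or-nothing transition at the critical probability `pc = pc n`: for every `ε > 0`, as
`n → ∞`, the normalized MMSE tends to `1` for `p ≥ (1 + ε) pc` and to `0` for `p ≤ (1 - ε) pc`.
Since `p` may vary with `n`, the limits are uniform over these ranges of `p ∈ [0,1]`. -/
def ExhibitsAoN {v : ℕ → ℕ} (H : ∀ n, SimpleGraph (Fin (v n))) (pc : ℕ → ℝ) : Prop :=
  ∀ ε : ℝ, 0 < ε → ∀ δ : ℝ, 0 < δ → ∀ᶠ n in atTop, ∀ p : unitInterval,
    ((1 + ε) * pc n ≤ (p : ℝ) → |normalizedMMSE (H n) n p - 1| < δ) ∧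
    ((p : ℝ) ≤ (1 - ε) * pc n → |normalizedMMSE (H n) n p| < δ)

/-! Write `N` for the number of pairs in a `k`-set, `M` for the number of `k`-sets, `X` for the
number of `k`-cliques of a graph, and `m = M p^N` for its mean under `G(n,p)`. For `p > 0`, Bayes'
rule shows that the posterior of the planted clique is uniform on the `k`-cliques of `Y`, and that
the law of `Y` is that of `G(n,p)` reweighted by `X / m`. Hence the normalized MMSE is one minus the
mean relative overlap of two independent posterior samples (`normalizedMMSE_eq`). This mean is an
expectation over `G(n,p)` of pair sums divided by `X`, and second moments control it.

A pair of `k`-sets sharing `l` vertices contributes to `E X² / m²` the chance of such an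
intersection, at most `C(k,l)² / C(n,l)`, times `p^(-C(l,2))`. At the threshold, where `m = 1`, this
product is at most `12^k` for every `l`, and far smaller for `l` up to about `k/2`. A change of `p`
by a constant factor changes the terms that matter by a factor exponential in `k²`, which beats
`12^k` when `k → ∞`. Above the threshold, all pairs with `l ≥ 2` become negligible: `X` concentrates
and the overlap vanishes (`expectedOverlap_le`). Below it, pairs of small overlap are negligible and
the posterior samples nearly agree (`one_sub_expectedOverlap_le`).

For bounded `k` the same factors are only constants. The MMSE stays away from 0 at twice the
threshold and away from 1 at eight times the threshold, and no critical value is compatible with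
both. -/

open scoped Finset

/-! ### The complete graph on a vertex set -/

/-- The graph whose edges are all pairs of distinct vertices of `S`. -/
def cliqueOn {V : Type*} (S : Finset V) : SimpleGraph V where
  Adj a b := a ∈ S ∧ b ∈ S ∧ a ≠ b
  symm := ⟨fun _ _ h => ⟨h.2.1, h.1, h.2.2.symm⟩⟩
  loopless := ⟨fun _ h => h.2.2 rfl⟩

theorem cliqueOn_inf {V : Type*} [DecidableEq V] (S T : Finset V) :
    cliqueOn S ⊓ cliqueOn T = cliqueOn (S ∩ T) := by
  ext a b
  simp only [SimpleGraph.inf_adj, cliqueOn, Finset.mem_inter]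
  tauto

theorem edgeSet_cliqueOn {V : Type*} [DecidableEq V] (S : Finset V) :
    (cliqueOn S).edgeSet = (S.offDiag.image Sym2.mk.uncurry : Finset (Sym2 V)) := by
  ext e
  induction e using Sym2.ind with
  | _ a b =>
    simp only [SimpleGraph.mem_edgeSet, cliqueOn, Finset.coe_image, Set.mem_image,
      Finset.mem_coe, Finset.mem_offDiag, Prod.exists, Function.uncurry, Sym2.eq_iff]
    constructor
    · exact fun h => ⟨a, b, h, Or.inl ⟨rfl, rfl⟩⟩
    · rintro ⟨c, d, h, ⟨rfl, rfl⟩ | ⟨rfl, rfl⟩⟩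
      · exact h
      · exact ⟨h.2.1, h.1, h.2.2.symm⟩

theorem ncard_edgeSet_cliqueOn {V : Type*} (S : Finset V) :
    (cliqueOn S).edgeSet.ncard = (#S).choose 2 := by
  classical
  rw [edgeSet_cliqueOn, Set.ncard_coe_finset]
  exact Sym2.card_image_offDiag S

theorem ncard_edgeSet_sup_add_inf {V : Type*} [Finite V] (A B : SimpleGraph V) :
    (A ⊔ B).edgeSet.ncard + (A ⊓ B).edgeSet.ncard = A.edgeSet.ncard + B.edgeSet.ncard := by
  rw [SimpleGraph.edgeSet_sup, SimpleGraph.edgeSet_inf]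
  exact Set.ncard_union_add_ncard_inter _ _ (Set.toFinite _) (Set.toFinite _)

theorem ncard_edgeSet_cliqueOn_sup {n : ℕ} (S T : Finset (Fin n)) :
    (cliqueOn S ⊔ cliqueOn T).edgeSet.ncard + (#(S ∩ T)).choose 2
      = (#S).choose 2 + (#T).choose 2 := by
  have h := ncard_edgeSet_sup_add_inf (cliqueOn S) (cliqueOn T)
  rwa [cliqueOn_inf, ncard_edgeSet_cliqueOn, ncard_edgeSet_cliqueOn, ncard_edgeSet_cliqueOn] at h

/-- Sets with fewer than two vertices all give the empty graph, hence the size hypotheses. -/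
theorem cliqueOn_injOn {V : Type*} {S T : Finset V} (hS : 2 ≤ #S) (hT : 2 ≤ #T)
    (h : cliqueOn S = cliqueOn T) : S = T := by
  have key : ∀ {A B : Finset V}, 2 ≤ #A → cliqueOn A = cliqueOn B → A ⊆ B := by
    intro A B hA hAB a ha
    obtain ⟨b, hb, hba⟩ := Finset.exists_mem_ne (by omega : 1 < #A) a
    have : (cliqueOn A).Adj a b := ⟨ha, hb, hba.symm⟩
    rw [hAB] at this
    exact this.1
  exact Finset.Subset.antisymm (key hS h) (key hT h.symm)

theorem graphCopies_top (k n : ℕ) :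
    graphCopies (⊤ : SimpleGraph (Fin k)) n
      = cliqueOn '' (Finset.univ.powersetCard k : Finset (Finset (Fin n))) := by
  ext G
  simp only [graphCopies, Set.mem_range, Set.mem_image, Finset.mem_coe, Finset.mem_powersetCard,
    Finset.subset_univ, true_and]
  have key : ∀ f : Fin k ↪ Fin n, (⊤ : SimpleGraph (Fin k)).map f
      = cliqueOn (Finset.univ.map f) := by
    intro f
    ext a b
    simp only [SimpleGraph.map_adj, SimpleGraph.top_adj, cliqueOn, Finset.mem_map,
      Finset.mem_univ, true_and]
    constructor
    · rintro ⟨u, v, huv, rfl, rfl⟩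
      exact ⟨⟨u, rfl⟩, ⟨v, rfl⟩, fun h => huv (f.injective h)⟩
    · rintro ⟨⟨u, rfl⟩, ⟨v, rfl⟩, h⟩
      exact ⟨u, v, fun e => h (by rw [e]), rfl, rfl⟩
  constructor
  · rintro ⟨f, rfl⟩
    exact ⟨Finset.univ.map f, by simp, (key f).symm⟩
  · rintro ⟨S, hS, rfl⟩
    refine ⟨(S.orderEmbOfFin hS).toEmbedding, ?_⟩
    rw [key]
    congr 1
    ext a
    have := S.range_orderEmbOfFin hS
    rw [← Finset.mem_coe (s := S), ← this]
    simp

/-! ### The binomial random graph -/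

instance {n : ℕ} : MeasurableSingletonClass (SimpleGraph (Fin n)) where
  measurableSet_singleton y := by
    have : ({y} : Set (SimpleGraph (Fin n))) = SimpleGraph.edgeSet ⁻¹' {y.edgeSet} := by
      ext z
      simp
    rw [this]
    exact SimpleGraph.measurable_edgeSet (MeasurableSet.singleton _)

/-- The probability that `G(n,p)` equals `y`. -/
noncomputable def graphWeight (n : ℕ) (p : unitInterval) (y : SimpleGraph (Fin n)) : ℝ :=
  (SimpleGraph.binomialRandom (Fin n) p).real {y}

theorem graphWeight_eq (n : ℕ) (p : unitInterval) (y : SimpleGraph (Fin n)) :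
    graphWeight n p y = (p : ℝ) ^ y.edgeSet.ncard
      * (1 - (p : ℝ)) ^ (n.choose 2 - y.edgeSet.ncard) := by
  rw [graphWeight, measureReal_def, SimpleGraph.binomialRandom_singleton]
  simp

theorem graphWeight_nonneg (n : ℕ) (p : unitInterval) (y : SimpleGraph (Fin n)) :
    0 ≤ graphWeight n p y := measureReal_nonneg

theorem integral_binomialRandom (n : ℕ) (p : unitInterval) (f : SimpleGraph (Fin n) → ℝ) :
    ∫ g, f g ∂(SimpleGraph.binomialRandom (Fin n) p) = ∑ g, graphWeight n p g * f g := by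
  rw [integral_fintype .of_finite]
  rfl

theorem sum_graphWeight (n : ℕ) (p : unitInterval) : ∑ g, graphWeight n p g = 1 := by
  have h := integral_binomialRandom n p (fun _ => 1)
  simpa using h.symm

theorem ncard_edgeSet_le {n : ℕ} (y : SimpleGraph (Fin n)) : y.edgeSet.ncard ≤ n.choose 2 := by
  classical
  rw [← SimpleGraph.coe_edgeFinset, Set.ncard_coe_finset]
  simpa using y.card_edgeFinset_le_card_choose_two

-- The solutions `g` of `h ⊔ g = y` are `y \ h` together with an arbitrary subset of the edges of
-- `h`; by the binomial theorem the choice of that subset has total weight one. The factor `p ^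
-- h.edgeSet.ncard` multiplies the left side instead of dividing the right, so that `p = 0` is
-- allowed.
open scoped Classical in
theorem sum_graphWeight_sup_eq (n : ℕ) (p : unitInterval) (h y : SimpleGraph (Fin n)) :
    (∑ g with h ⊔ g = y, graphWeight n p g) * (p : ℝ) ^ h.edgeSet.ncard
      = if h ≤ y then graphWeight n p y else 0 := by
  split_ifs with hy
  · set B := (y \ h).edgeSet.ncard with hB
    set A := h.edgeSet.ncard with hA
    have hdisj : ∀ T : Set (Sym2 (Fin n)), T ⊆ h.edgeSet → Disjoint (y \ h).edgeSet T := by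
      intro T hT
      rw [SimpleGraph.edgeSet_sdiff]
      exact Set.disjoint_sdiff_left.mono_right hT
    have hyAB : y.edgeSet.ncard = B + A := by
      rw [hB, hA, SimpleGraph.edgeSet_sdiff]
      exact (Set.ncard_sdiff_add_ncard_of_subset (SimpleGraph.edgeSet_mono hy)
        (Set.toFinite _)).symm
    have hle := ncard_edgeSet_le y
    have hcardA : #h.edgeFinset = A := by
      rw [hA, ← SimpleGraph.coe_edgeFinset, Set.ncard_coe_finset]
    have hsum : ∑ g with h ⊔ g = y, graphWeight n p g
        = ∑ T ∈ h.edgeFinset.powerset, (p : ℝ) ^ (B + #T) * (1 - (p : ℝ)) ^ (n.choose 2 - (B + #T)) := by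
      refine Finset.sum_bij' (fun g _ => h.edgeFinset ∩ g.edgeFinset)
        (fun T _ => (y \ h) ⊔ SimpleGraph.fromEdgeSet (T : Set (Sym2 (Fin n)))) ?_ ?_ ?_ ?_ ?_
      · intro g _
        simp [Finset.inter_subset_left]
      · intro T hT
        have hT' : (T : Set (Sym2 (Fin n))) ⊆ h.edgeSet := by
          intro e he
          simpa using Finset.mem_powerset.1 hT he
        have : SimpleGraph.fromEdgeSet (T : Set (Sym2 (Fin n))) ≤ h := by
          intro a b hab
          rw [SimpleGraph.fromEdgeSet_adj] at hab
          exact hT' hab.1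
        simp only [Finset.mem_filter, Finset.mem_univ, true_and]
        rw [← sup_assoc, sup_sdiff_cancel_right hy]
        exact sup_eq_left.2 (this.trans hy)
      · intro g hg
        simp only [Finset.mem_filter, Finset.mem_univ, true_and] at hg
        subst hg
        ext a b
        simp only [SimpleGraph.sup_adj, SimpleGraph.sdiff_adj, SimpleGraph.fromEdgeSet_adj,
          Finset.coe_inter, SimpleGraph.coe_edgeFinset, Set.mem_inter_iff, SimpleGraph.mem_edgeSet]
        have := fun hab : g.Adj a b => hab.ne
        tauto
      · intro T hT
        have hT' : ∀ e ∈ T, e ∈ h.edgeSet := fun e he => by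
          simpa using Finset.mem_powerset.1 hT he
        ext e
        have hd : e ∈ h.edgeSet → ¬ e.IsDiag := fun he => h.not_isDiag_of_mem_edgeSet he
        simp only [Finset.mem_inter, SimpleGraph.mem_edgeFinset, SimpleGraph.edgeSet_sup,
          SimpleGraph.edgeSet_sdiff, SimpleGraph.edgeSet_fromEdgeSet, Set.mem_union, Set.mem_sdiff,
          Finset.mem_coe, Sym2.mem_diagSet]
        have := hT' e
        tauto
      · intro g hg
        simp only [Finset.mem_filter, Finset.mem_univ, true_and] at hg
        have hsub : (y \ h) ≤ g := by
          rw [← hg, sup_sdiff_left_self]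
          exact sdiff_le
        have hg' : g.edgeSet.ncard = B + #(h.edgeFinset ∩ g.edgeFinset) := by
          rw [← Set.ncard_coe_finset, hB, ← Set.ncard_union_eq (hdisj _ (by simp))
            (Set.toFinite _) (Set.toFinite _)]
          congr 1
          rw [← hg]
          ext e
          simp only [SimpleGraph.edgeSet_sup, SimpleGraph.edgeSet_sdiff, Finset.coe_inter,
            SimpleGraph.coe_edgeFinset, Set.mem_union, Set.mem_sdiff, Set.mem_inter_iff]
          tauto
        rw [graphWeight_eq, hg']
    have hpow := Finset.sum_pow_mul_eq_add_pow (p : ℝ) (1 - (p : ℝ)) h.edgeFinset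
    rw [add_sub_cancel, one_pow, hcardA] at hpow
    have hfac : ∑ T ∈ h.edgeFinset.powerset,
        (p : ℝ) ^ (B + #T) * (1 - (p : ℝ)) ^ (n.choose 2 - (B + #T))
        = (p : ℝ) ^ B * (1 - (p : ℝ)) ^ (n.choose 2 - (B + A))
          * ∑ T ∈ h.edgeFinset.powerset, (p : ℝ) ^ #T * (1 - (p : ℝ)) ^ (A - #T) := by
      rw [Finset.mul_sum]
      refine Finset.sum_congr rfl fun T hT => ?_
      have hTc : #T ≤ A := hcardA ▸ Finset.card_le_card (Finset.mem_powerset.1 hT)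
      have : n.choose 2 - (B + #T) = (n.choose 2 - (B + A)) + (A - #T) := by omega
      rw [this, pow_add, pow_add]
      ring
    rw [hsum, hfac, hpow, graphWeight_eq, hyAB, pow_add]
    ring
  · rw [Finset.sum_eq_zero, zero_mul]
    intro g hg
    simp only [Finset.mem_filter, Finset.mem_univ, true_and] at hg
    exact absurd (hg ▸ le_sup_left) hy

open scoped Classical in
theorem sum_graphWeight_of_le {n : ℕ} {p : unitInterval} (h : SimpleGraph (Fin n)) :
    ∑ y with h ≤ y, graphWeight n p y = (p : ℝ) ^ h.edgeSet.ncard := by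
  rw [Finset.sum_filter]
  simp_rw [← sum_graphWeight_sup_eq n p h]
  rw [← Finset.sum_mul, Finset.sum_fiberwise Finset.univ (fun g => h ⊔ g) (graphWeight n p),
    sum_graphWeight, one_mul]

/-! ### The planted clique model -/

instance (k n : ℕ) (p : unitInterval) :
    IsFiniteMeasure (plantedLaw (⊤ : SimpleGraph (Fin k)) n p) := by
  unfold plantedLaw
  infer_instance

theorem integral_uniformOn_graphCopies_top {k n : ℕ} (hk : 2 ≤ k)
    (f : SimpleGraph (Fin n) → ℝ) :
    ∫ h, f h ∂(ProbabilityTheory.uniformOn (graphCopies (⊤ : SimpleGraph (Fin k)) n))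
      = (n.choose k : ℝ)⁻¹ * ∑ S ∈ (Finset.univ : Finset (Fin n)).powersetCard k,
          f (cliqueOn S) := by
  classical
  set P := (Finset.univ : Finset (Fin n)).powersetCard k with hP
  have hcopies : graphCopies (⊤ : SimpleGraph (Fin k)) n = (P.image cliqueOn : Finset _) := by
    rw [graphCopies_top, Finset.coe_image]
  have hinj : Set.InjOn cliqueOn (P : Set (Finset (Fin n))) := by
    intro S hS T hT h
    simp only [hP, Finset.mem_coe, Finset.mem_powersetCard_univ] at hS hT
    exact cliqueOn_injOn (hS ▸ hk) (hT ▸ hk) h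
  have hcard : #(P.image cliqueOn) = n.choose k := by
    rw [Finset.card_image_of_injOn hinj, hP, Finset.card_powersetCard, Finset.card_univ,
      Fintype.card_fin]
  rw [integral_fintype .of_finite, ← Finset.sum_image (f := f) hinj, Finset.mul_sum,
    ← Finset.sum_subset (Finset.subset_univ (P.image cliqueOn))]
  · refine Finset.sum_congr rfl fun h hh => ?_
    rw [measureReal_def, hcopies, ← Finset.coe_singleton,
      ProbabilityTheory.uniformOn_apply_finset, Finset.inter_singleton_of_mem hh, hcard]
    simp
  · intro h _ hh
    rw [measureReal_def, hcopies, ← Finset.coe_singleton,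
      ProbabilityTheory.uniformOn_apply_finset, Finset.inter_singleton_of_notMem hh]
    simp

theorem integral_plantedLaw_top {k n : ℕ} (hk : 2 ≤ k) (p : unitInterval)
    (f : SimpleGraph (Fin n) × SimpleGraph (Fin n) → ℝ) :
    ∫ ω, f ω ∂(plantedLaw (⊤ : SimpleGraph (Fin k)) n p)
      = (n.choose k : ℝ)⁻¹ * ∑ S ∈ (Finset.univ : Finset (Fin n)).powersetCard k,
          ∑ g, graphWeight n p g * f (cliqueOn S, g) := by
  have : IsFiniteMeasure (ProbabilityTheory.uniformOn (graphCopies (⊤ : SimpleGraph (Fin k)) n)) :=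
    inferInstance
  rw [plantedLaw, integral_prod _ .of_finite, integral_uniformOn_graphCopies_top hk]
  simp_rw [integral_binomialRandom]

open scoped Classical in
/-- The vertex sets of the `k`-cliques of `y`. -/
noncomputable def cliqueSets (k : ℕ) {n : ℕ} (y : SimpleGraph (Fin n)) : Finset (Finset (Fin n)) :=
  {S ∈ (Finset.univ : Finset (Fin n)).powersetCard k | cliqueOn S ≤ y}

theorem card_of_mem_cliqueSets {k n : ℕ} {y : SimpleGraph (Fin n)} {S : Finset (Fin n)}
    (hS : S ∈ cliqueSets k y) : #S = k := by
  classical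
  rw [cliqueSets, Finset.mem_filter] at hS
  simpa using hS.1

theorem sum_cliqueSets {k n : ℕ} (w : SimpleGraph (Fin n) → ℝ)
    (f : Finset (Fin n) → SimpleGraph (Fin n) → ℝ) :
    ∑ y, w y * ∑ S ∈ cliqueSets k y, f S y
      = ∑ S ∈ (Finset.univ : Finset (Fin n)).powersetCard k, ∑ y,
          (open scoped Classical in if cliqueOn S ≤ y then w y else 0) * f S y := by
  classical
  rw [Finset.sum_comm]
  refine Finset.sum_congr rfl fun y _ => ?_
  rw [cliqueSets, Finset.sum_filter, Finset.mul_sum]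
  refine Finset.sum_congr rfl fun S _ => ?_
  split_ifs <;> simp

/-- Change of measure: the pair (planted set `S`, observed graph `y`) has mass `graphWeight n p y /
(M p^N)` if `S` spans a clique of `y`, and zero otherwise. -/
theorem integral_plantedLaw_top_observedGraph {k n : ℕ} (hk : 2 ≤ k) {p : unitInterval}
    (hp : 0 < (p : ℝ)) (f : SimpleGraph (Fin n) → SimpleGraph (Fin n) → ℝ) :
    ∫ ω, f ω.1 (observedGraph ω) ∂(plantedLaw (⊤ : SimpleGraph (Fin k)) n p)
      = (n.choose k * (p : ℝ) ^ k.choose 2)⁻¹ *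
        ∑ y, graphWeight n p y * ∑ S ∈ cliqueSets k y, f (cliqueOn S) y := by
  classical
  rw [integral_plantedLaw_top hk, sum_cliqueSets, mul_inv, mul_assoc]
  congr 1
  rw [Finset.mul_sum]
  refine Finset.sum_congr rfl fun S hS => ?_
  have hSk : (cliqueOn S).edgeSet.ncard = k.choose 2 := by
    rw [ncard_edgeSet_cliqueOn, (Finset.mem_powersetCard_univ.1 hS)]
  rw [← Finset.sum_fiberwise Finset.univ (fun g => cliqueOn S ⊔ g)
    (fun g => graphWeight n p g * f (cliqueOn S) (observedGraph (cliqueOn S, g))), Finset.mul_sum]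
  refine Finset.sum_congr rfl fun y _ => ?_
  have h := sum_graphWeight_sup_eq n p (cliqueOn S) y
  rw [hSk] at h
  have h2 : ∑ g with cliqueOn S ⊔ g = y,
      graphWeight n p g * f (cliqueOn S) (observedGraph (cliqueOn S, g))
      = (∑ g with cliqueOn S ⊔ g = y, graphWeight n p g) * f (cliqueOn S) y := by
    rw [Finset.sum_mul]
    refine Finset.sum_congr rfl fun g hg => ?_
    simp only [Finset.mem_filter, Finset.mem_univ, true_and] at hg
    rw [observedGraph, hg]
  rw [h2]
  rw [← h]
  field_simp

open scoped Classical in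
theorem posteriorMean_eq_div {k n : ℕ} (p : unitInterval) (y : SimpleGraph (Fin n))
    (e : Sym2 (Fin n)) :
    posteriorMean (⊤ : SimpleGraph (Fin k)) n p y e
      = (∫ ω, (if observedGraph ω = y then edgeCoord ω.1 e else 0)
            ∂(plantedLaw (⊤ : SimpleGraph (Fin k)) n p)) /
        (∫ ω, (if observedGraph ω = y then 1 else 0)
            ∂(plantedLaw (⊤ : SimpleGraph (Fin k)) n p)) := by
  have hm : MeasurableSet (observedGraph ⁻¹' {y} :
      Set (SimpleGraph (Fin n) × SimpleGraph (Fin n))) := (Set.toFinite _).measurableSet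
  have h1 := integral_indicator (f := fun ω : SimpleGraph (Fin n) × SimpleGraph (Fin n) =>
    edgeCoord ω.1 e) (μ := plantedLaw (⊤ : SimpleGraph (Fin k)) n p) hm
  have h2 := integral_indicator_one (μ := plantedLaw (⊤ : SimpleGraph (Fin k)) n p) hm
  rw [posteriorMean, ProbabilityTheory.cond, integral_smul_measure, ← h1, smul_eq_mul,
    ENNReal.toReal_inv, ← measureReal_def, ← h2, inv_mul_eq_div]
  simp only [Set.indicator_apply, Set.mem_preimage, Set.mem_singleton_iff, Pi.one_apply]

/-- That mass does not depend on `S`, so the posterior is uniform on the cliques of `y`. Outcomes of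
weight zero are excluded, since conditioning on them is degenerate. -/
theorem posteriorMean_eq {k n : ℕ} (hk : 2 ≤ k) {p : unitInterval} (hp : 0 < (p : ℝ))
    {y : SimpleGraph (Fin n)} (hy : graphWeight n p y ≠ 0) (hM : k ≤ n) (e : Sym2 (Fin n)) :
    posteriorMean (⊤ : SimpleGraph (Fin k)) n p y e
      = (∑ S ∈ cliqueSets k y, edgeCoord (cliqueOn S) e) / #(cliqueSets k y) := by
  classical
  have hM' : (n.choose k : ℝ) ≠ 0 := by exact_mod_cast (Nat.choose_pos hM).ne'
  rw [posteriorMean_eq_div,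
    integral_plantedLaw_top_observedGraph hk hp (fun h z => if z = y then edgeCoord h e else 0),
    integral_plantedLaw_top_observedGraph hk hp (fun h z => if z = y then 1 else 0)]
  have key : ∀ f : SimpleGraph (Fin n) → ℝ, ∑ z, graphWeight n p z *
      ∑ S ∈ cliqueSets k z, (if z = y then f (cliqueOn S) else 0)
      = graphWeight n p y * ∑ S ∈ cliqueSets k y, f (cliqueOn S) := by
    intro f
    rw [Finset.sum_eq_single y]
    · simp
    · intro z _ hz
      simp [hz]
    · simp
  rw [key (fun h => edgeCoord h e), key (fun _ => 1)]
  have hpN : (p : ℝ) ^ k.choose 2 ≠ 0 := (pow_pos hp _).ne'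
  rw [mul_div_mul_left _ _ (inv_ne_zero (mul_ne_zero hM' hpN)), mul_div_mul_left _ _ hy]
  simp

/-! ### Squared error in terms of clique overlaps -/

theorem sum_edgeCoord {n : ℕ} (A : SimpleGraph (Fin n)) :
    ∑ e ∈ (⊤ : SimpleGraph (Fin n)).edgeFinset, edgeCoord A e = A.edgeSet.ncard := by
  classical
  have : A.edgeFinset ⊆ (⊤ : SimpleGraph (Fin n)).edgeFinset :=
    SimpleGraph.edgeFinset_mono le_top
  rw [← SimpleGraph.coe_edgeFinset A, Set.ncard_coe_finset]
  simp only [edgeCoord, Set.indicator_apply, Finset.sum_ite, Finset.sum_const_zero, add_zero,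
    Finset.sum_const, nsmul_eq_mul, mul_one]
  congr 2
  ext e
  simp only [Finset.mem_filter, SimpleGraph.mem_edgeFinset]
  exact ⟨fun h => h.2, fun h => ⟨by simpa using this (by simpa using h), h⟩⟩

theorem edgeCoord_mul {n : ℕ} (A B : SimpleGraph (Fin n)) (e : Sym2 (Fin n)) :
    edgeCoord A e * edgeCoord B e = edgeCoord (A ⊓ B) e := by
  classical
  simp only [edgeCoord, Set.indicator_apply, SimpleGraph.edgeSet_inf, Set.mem_inter_iff]
  split_ifs <;> simp_all

theorem sum_edgeCoord_cliqueOn_mul {n : ℕ} (S T : Finset (Fin n)) :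
    ∑ e ∈ (⊤ : SimpleGraph (Fin n)).edgeFinset, edgeCoord (cliqueOn S) e * edgeCoord (cliqueOn T) e
      = ((#(S ∩ T)).choose 2 : ℝ) := by
  simp_rw [edgeCoord_mul]
  rw [sum_edgeCoord, cliqueOn_inf, ncard_edgeSet_cliqueOn]

theorem sum_sq_sub_mean {ι : Type*} (s : Finset ι) (x : ι → ℝ) :
    ∑ i ∈ s, (x i - (∑ j ∈ s, x j) / #s) ^ 2
      = ∑ i ∈ s, x i * x i - (∑ i ∈ s, ∑ j ∈ s, x i * x j) / #s := by
  rcases s.eq_empty_or_nonempty with rfl | hs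
  · simp
  have hc : (#s : ℝ) ≠ 0 := by exact_mod_cast hs.card_pos.ne'
  rw [← Finset.sum_mul_sum]
  simp only [sub_sq, Finset.sum_add_distrib, Finset.sum_sub_distrib, Finset.sum_const,
    nsmul_eq_mul, ← Finset.sum_mul, ← Finset.mul_sum]
  field_simp
  simp only [pow_two]
  ring

/-- The overlap of two `k`-cliques as a fraction of the number of their edges. -/
noncomputable def overlap {n : ℕ} (k : ℕ) (S T : Finset (Fin n)) : ℝ :=
  ((#(S ∩ T)).choose 2 : ℝ) / (k.choose 2 : ℝ)

/-- The expected relative overlap of the planted clique with a sample from the posterior law. -/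
noncomputable def expectedOverlap (k n : ℕ) (p : unitInterval) : ℝ :=
  (n.choose k * (p : ℝ) ^ k.choose 2)⁻¹ * ∑ y, graphWeight n p y *
    ((∑ S ∈ cliqueSets k y, ∑ T ∈ cliqueSets k y, overlap k S T) / #(cliqueSets k y))

theorem sum_graphWeight_mul_sum_cliqueSets {k n : ℕ} (p : unitInterval)
    (f : Finset (Fin n) → ℝ) :
    ∑ y, graphWeight n p y * ∑ S ∈ cliqueSets k y, f S
      = (p : ℝ) ^ k.choose 2 * ∑ S ∈ (Finset.univ : Finset (Fin n)).powersetCard k, f S := by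
  classical
  rw [sum_cliqueSets _ (fun S _ => f S), Finset.mul_sum]
  refine Finset.sum_congr rfl fun S hS => ?_
  rw [← Finset.sum_mul, ← Finset.sum_filter, sum_graphWeight_of_le, ncard_edgeSet_cliqueOn,
    Finset.mem_powersetCard_univ.1 hS]

theorem sum_graphWeight_mul_card_cliqueSets {k n : ℕ} (p : unitInterval) :
    ∑ y : SimpleGraph (Fin n), graphWeight n p y * #(cliqueSets k y)
      = n.choose k * (p : ℝ) ^ k.choose 2 := by
  have h := sum_graphWeight_mul_sum_cliqueSets (k := k) (n := n) p (fun _ => 1)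
  simp only [Finset.sum_const, nsmul_eq_mul, mul_one, Finset.card_powersetCard, Finset.card_univ,
    Fintype.card_fin] at h
  rw [h, mul_comm]

/-- Two `k`-cliques on `S` and `T` share the edges inside `S ∩ T`, so both are present with
probability `p^(2N - C(|S ∩ T|, 2))`. -/
theorem sum_graphWeight_mul_sum_sum_cliqueSets {k n : ℕ} {p : unitInterval} (hp : 0 < (p : ℝ))
    (f : Finset (Fin n) → Finset (Fin n) → ℝ) :
    ∑ y, graphWeight n p y * ∑ S ∈ cliqueSets k y, ∑ T ∈ cliqueSets k y, f S T
      = ((p : ℝ) ^ k.choose 2) ^ 2 * ∑ S ∈ (Finset.univ : Finset (Fin n)).powersetCard k,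
          ∑ T ∈ (Finset.univ : Finset (Fin n)).powersetCard k,
            f S T * ((p : ℝ) ^ (#(S ∩ T)).choose 2)⁻¹ := by
  classical
  rw [sum_cliqueSets _ (fun S y => ∑ T ∈ cliqueSets k y, f S T), Finset.mul_sum]
  refine Finset.sum_congr rfl fun S hS => ?_
  rw [sum_cliqueSets _ (fun T y => f S T), Finset.mul_sum]
  refine Finset.sum_congr rfl fun T hT => ?_
  have h1 : ∀ y : SimpleGraph (Fin n),
      (if cliqueOn T ≤ y then (if cliqueOn S ≤ y then graphWeight n p y else 0) else 0)
      = if cliqueOn S ⊔ cliqueOn T ≤ y then graphWeight n p y else 0 := by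
    intro y
    rw [sup_le_iff]
    split_ifs <;> simp_all
  simp_rw [h1]
  have h2 := ncard_edgeSet_cliqueOn_sup S T
  rw [Finset.mem_powersetCard_univ.1 hS, Finset.mem_powersetCard_univ.1 hT] at h2
  rw [← Finset.sum_mul, ← Finset.sum_filter, sum_graphWeight_of_le, ← pow_mul, mul_two, ← h2,
    pow_add]
  have : (p : ℝ) ^ (#(S ∩ T)).choose 2 ≠ 0 := (pow_pos hp _).ne'
  field_simp

theorem ncard_edgeSet_top (k : ℕ) : (⊤ : SimpleGraph (Fin k)).edgeSet.ncard = k.choose 2 := by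
  classical
  rw [← SimpleGraph.coe_edgeFinset, Set.ncard_coe_finset, SimpleGraph.card_edgeFinset_top_eq_card_choose_two,
    Fintype.card_fin]

/-- The posterior mean is the average of the clique vectors, so the squared error is a variance.
Each vector has squared norm `N`, and inner products of two of them count common edges. -/
theorem normalizedMMSE_eq {k n : ℕ} (hk : 2 ≤ k) (hkn : k ≤ n) {p : unitInterval}
    (hp : 0 < (p : ℝ)) :
    normalizedMMSE (⊤ : SimpleGraph (Fin k)) n p = 1 - expectedOverlap k n p := by
  classical
  have hN : (k.choose 2 : ℝ) ≠ 0 := by exact_mod_cast (Nat.choose_pos hk).ne'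
  have hM : (n.choose k : ℝ) ≠ 0 := by exact_mod_cast (Nat.choose_pos hkn).ne'
  have hpN : (p : ℝ) ^ k.choose 2 ≠ 0 := (pow_pos hp _).ne'
  rw [normalizedMMSE, plantedMMSE, ncard_edgeSet_top,
    integral_plantedLaw_top_observedGraph hk hp (fun h y =>
      ∑ e ∈ (⊤ : SimpleGraph (Fin n)).edgeFinset,
        (edgeCoord h e - posteriorMean (⊤ : SimpleGraph (Fin k)) n p y e) ^ 2)]
  have hterm : ∀ y : SimpleGraph (Fin n), graphWeight n p y * ∑ S ∈ cliqueSets k y,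
      ∑ e ∈ (⊤ : SimpleGraph (Fin n)).edgeFinset,
        (edgeCoord (cliqueOn S) e - posteriorMean (⊤ : SimpleGraph (Fin k)) n p y e) ^ 2
      = k.choose 2 * (graphWeight n p y * #(cliqueSets k y)) - k.choose 2 * (graphWeight n p y *
        ((∑ S ∈ cliqueSets k y, ∑ T ∈ cliqueSets k y, overlap k S T) / #(cliqueSets k y))) := by
    intro y
    by_cases hy : graphWeight n p y = 0
    · simp [hy]
    simp_rw [posteriorMean_eq hk hp hy hkn]
    rw [Finset.sum_comm]
    simp_rw [sum_sq_sub_mean]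
    rw [Finset.sum_sub_distrib, Finset.sum_comm, ← Finset.sum_div]
    simp_rw [sum_edgeCoord_cliqueOn_mul]
    rw [Finset.sum_comm]
    have h1 : ∀ S ∈ cliqueSets k y, ∑ e ∈ (⊤ : SimpleGraph (Fin n)).edgeFinset,
        ∑ T ∈ cliqueSets k y, edgeCoord (cliqueOn S) e * edgeCoord (cliqueOn T) e
        = ∑ T ∈ cliqueSets k y, k.choose 2 * overlap k S T := by
      intro S _
      rw [Finset.sum_comm]
      refine Finset.sum_congr rfl fun T _ => ?_
      rw [sum_edgeCoord_cliqueOn_mul, overlap]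
      field_simp
    have h2 : ∑ S ∈ cliqueSets k y, ((#(S ∩ S)).choose 2 : ℝ)
        = #(cliqueSets k y) * k.choose 2 := by
      rw [← nsmul_eq_mul, ← Finset.sum_const]
      refine Finset.sum_congr rfl fun S hS => ?_
      rw [Finset.inter_self, card_of_mem_cliqueSets hS]
    rw [h2, Finset.sum_congr rfl h1]
    simp_rw [← Finset.mul_sum]
    ring
  simp_rw [hterm]
  rw [Finset.sum_sub_distrib, ← Finset.mul_sum, ← Finset.mul_sum,
    sum_graphWeight_mul_card_cliqueSets, expectedOverlap]
  field_simp

/-- Here the observation is the planted clique itself. The case is separate because the change of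
measure divides by a power of `p`. -/
theorem normalizedMMSE_zero {k n : ℕ} (hk : 2 ≤ k) (hkn : k ≤ n) {p : unitInterval}
    (hp : (p : ℝ) = 0) :
    normalizedMMSE (⊤ : SimpleGraph (Fin k)) n p = 0 := by
  classical
  have hM : (n.choose k : ℝ) ≠ 0 := by exact_mod_cast (Nat.choose_pos hkn).ne'
  have hw : ∀ g : SimpleGraph (Fin n), graphWeight n p g = if g = ⊥ then 1 else 0 := by
    intro g
    have hp' : p = 0 := Subtype.ext hp
    rw [graphWeight, hp', SimpleGraph.binomialRandom_zero, measureReal_def,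
      Measure.dirac_apply' _ (MeasurableSet.singleton _)]
    by_cases h : g = ⊥ <;> simp [h, eq_comm]
  have hint : ∀ f : SimpleGraph (Fin n) × SimpleGraph (Fin n) → ℝ,
      ∫ ω, f ω ∂(plantedLaw (⊤ : SimpleGraph (Fin k)) n p)
      = (n.choose k : ℝ)⁻¹ * ∑ S ∈ (Finset.univ : Finset (Fin n)).powersetCard k,
          f (cliqueOn S, ⊥) := by
    intro f
    rw [integral_plantedLaw_top hk]
    simp [hw]
  rw [normalizedMMSE, plantedMMSE, hint, Finset.sum_eq_zero, mul_zero, zero_div]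
  intro S hS
  refine Finset.sum_eq_zero fun e _ => ?_
  have hobs : ∀ T : Finset (Fin n), observedGraph (cliqueOn T, (⊥ : SimpleGraph (Fin n)))
      = cliqueOn T := fun T => sup_bot_eq _
  have hsum : ∀ f : SimpleGraph (Fin n) → ℝ,
      ∑ T ∈ (Finset.univ : Finset (Fin n)).powersetCard k,
        (if cliqueOn T = cliqueOn S then f (cliqueOn T) else 0) = f (cliqueOn S) := by
    intro f
    rw [Finset.sum_eq_single S]
    · simp
    · intro T hT hTS
      rw [if_neg]
      intro h
      exact hTS (cliqueOn_injOn ((Finset.mem_powersetCard_univ.1 hT) ▸ hk)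
        ((Finset.mem_powersetCard_univ.1 hS) ▸ hk) h)
    · exact fun h => absurd hS h
  rw [posteriorMean_eq_div, hint, hint]
  simp only [hobs]
  rw [hsum (fun h => edgeCoord h e), hsum (fun _ => 1),
    mul_div_mul_left _ _ (inv_ne_zero hM), div_one, sub_self, zero_pow two_ne_zero]

/-! ### Counting pairs of vertex sets by the size of their intersection -/

/-- Such a `T` contains `L` and is determined by `T \ L`. Dropping the requirement that `T \ L`
avoid `S` leaves an upper bound, which suffices. -/
theorem card_filter_inter_eq_le {n k : ℕ} (S L : Finset (Fin n)) :
    #{T ∈ (Finset.univ : Finset (Fin n)).powersetCard k | S ∩ T = L}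
      ≤ (n - #L).choose (k - #L) := by
  have hc : #((Finset.univ \ L).powersetCard (k - #L)) = (n - #L).choose (k - #L) := by
    rw [Finset.card_powersetCard, Finset.card_sdiff_of_subset (Finset.subset_univ L),
      Finset.card_univ, Fintype.card_fin]
  rw [← hc]
  have hsub : ∀ T ∈ ({T ∈ (Finset.univ : Finset (Fin n)).powersetCard k | S ∩ T = L} :
      Finset (Finset (Fin n))), #T = k ∧ L ⊆ T := by
    intro T hT
    rw [Finset.mem_filter, Finset.mem_powersetCard_univ] at hT
    exact ⟨hT.1, hT.2 ▸ Finset.inter_subset_right⟩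
  refine Finset.card_le_card_of_injOn (fun T => T \ L) ?_ ?_
  · intro T hT
    obtain ⟨h1, h2⟩ := hsub T hT
    simp only [Finset.mem_coe, Finset.mem_powersetCard]
    exact ⟨Finset.sdiff_subset_sdiff (Finset.subset_univ _) le_rfl, by
      rw [Finset.card_sdiff_of_subset h2, h1]⟩
  · intro T hT T' hT' h
    rw [← Finset.sdiff_union_of_subset (hsub T hT).2, ← Finset.sdiff_union_of_subset (hsub T' hT').2]
    simp only at h
    rw [h]

/-- An upper bound for the probability that a random `k`-set meets a fixed one in `l` elements. -/
noncomputable def interWeight (n k l : ℕ) : ℝ := (k.choose l : ℝ) ^ 2 / (n.choose l : ℝ)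

theorem interWeight_nonneg (n k l : ℕ) : 0 ≤ interWeight n k l := by
  unfold interWeight
  positivity

theorem sum_sum_card_inter_le {n k : ℕ} (hkn : k ≤ n) {F : ℕ → ℝ} (hF : ∀ l, 0 ≤ F l) :
    ∑ S ∈ (Finset.univ : Finset (Fin n)).powersetCard k,
      ∑ T ∈ (Finset.univ : Finset (Fin n)).powersetCard k, F #(S ∩ T)
      ≤ (n.choose k : ℝ) ^ 2 * ∑ l ∈ Finset.range (k + 1), interWeight n k l * F l := by
  have hS : ∀ S ∈ (Finset.univ : Finset (Fin n)).powersetCard k,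
      ∑ T ∈ (Finset.univ : Finset (Fin n)).powersetCard k, F #(S ∩ T)
      ≤ (n.choose k : ℝ) * ∑ l ∈ Finset.range (k + 1), interWeight n k l * F l := by
    intro S hS
    rw [Finset.mem_powersetCard_univ] at hS
    have h1 : ∑ T ∈ (Finset.univ : Finset (Fin n)).powersetCard k, F #(S ∩ T)
        = ∑ L ∈ S.powerset, ∑ T ∈ (Finset.univ : Finset (Fin n)).powersetCard k with S ∩ T = L,
            F #(S ∩ T) :=
      (Finset.sum_fiberwise_of_maps_to
        (fun T _ => Finset.mem_powerset.2 Finset.inter_subset_left) _).symm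
    have h2 : ∀ L ∈ S.powerset,
        ∑ T ∈ (Finset.univ : Finset (Fin n)).powersetCard k with S ∩ T = L, F #(S ∩ T)
        ≤ ((n - #L).choose (k - #L) : ℝ) * F #L := by
      intro L _
      rw [Finset.sum_congr rfl (g := fun _ => F #L)
        (fun T hT => by rw [(Finset.mem_filter.1 hT).2]), Finset.sum_const, nsmul_eq_mul]
      exact mul_le_mul_of_nonneg_right (by exact_mod_cast card_filter_inter_eq_le S L) (hF _)
    rw [h1]
    refine (Finset.sum_le_sum h2).trans_eq ?_
    rw [Finset.sum_powerset_apply_card (fun l => ((n - l).choose (k - l) : ℝ) * F l), hS,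
      Finset.mul_sum]
    refine Finset.sum_congr rfl fun l hl => ?_
    have hlk : l ≤ k := Nat.lt_succ_iff.1 (Finset.mem_range.1 hl)
    have hc : (n.choose k : ℝ) * k.choose l = n.choose l * (n - l).choose (k - l) := by
      exact_mod_cast Nat.choose_mul hlk
    have hn : (n.choose l : ℝ) ≠ 0 := by
      exact_mod_cast (Nat.choose_pos (hlk.trans hkn)).ne'
    rw [nsmul_eq_mul, interWeight]
    field_simp
    linear_combination (-(k.choose l : ℝ) * F l) * hc
  refine (Finset.sum_le_sum hS).trans_eq ?_
  rw [Finset.sum_const, Finset.card_powersetCard, Finset.card_univ, Fintype.card_fin, nsmul_eq_mul]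
  ring

/-! ### Moment bounds for the expected overlap -/

theorem overlap_nonneg {n k : ℕ} (S T : Finset (Fin n)) : 0 ≤ overlap k S T := by
  unfold overlap
  positivity

theorem overlap_le_one {n k : ℕ} {S : Finset (Fin n)} (hS : #S = k) (T : Finset (Fin n)) :
    overlap k S T ≤ 1 := by
  unfold overlap
  refine div_le_one_of_le₀ ?_ (by positivity)
  exact_mod_cast Nat.choose_le_choose 2 (hS ▸ Finset.card_le_card Finset.inter_subset_left)

theorem overlap_self {n k : ℕ} (hk : 2 ≤ k) {S : Finset (Fin n)} (hS : #S = k) :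
    overlap k S S = 1 := by
  have hN : (k.choose 2 : ℝ) ≠ 0 := by exact_mod_cast (Nat.choose_pos hk).ne'
  rw [overlap, Finset.inter_self, hS, div_self hN]

theorem overlap_of_ne {n k : ℕ} (hk : 2 ≤ k) {S T : Finset (Fin n)} (hS : #S = k) (hT : #T = k)
    (hST : S ≠ T) : overlap k S T ≤ 1 - 1 / (k.choose 2 : ℝ) := by
  have hN : (0 : ℝ) < k.choose 2 := by exact_mod_cast Nat.choose_pos hk
  have hlt : #(S ∩ T) < k := by
    rw [← hS]
    refine Finset.card_lt_card (Finset.inter_subset_left.ssubset_of_ne fun h => hST ?_)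
    exact Finset.eq_of_subset_of_card_le (Finset.inter_eq_left.1 h) (by rw [hS, hT])
  have h2 : (#(S ∩ T)).choose 2 + 1 ≤ k.choose 2 := by
    obtain ⟨j, rfl⟩ : ∃ j, k = j + 1 := ⟨k - 1, by omega⟩
    have h3 : (#(S ∩ T)).choose 2 ≤ j.choose 2 := Nat.choose_le_choose 2 (by omega)
    have h4 : (j + 1).choose 2 = j.choose 1 + j.choose 2 := Nat.choose_succ_succ' j 1
    rw [Nat.choose_one_right] at h4
    omega
  have h3 : ((#(S ∩ T)).choose 2 : ℝ) + 1 ≤ k.choose 2 := by exact_mod_cast h2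
  rw [overlap, one_sub_div hN.ne', div_le_div_iff_of_pos_right hN]
  linarith

theorem expectedOverlap_nonneg (k n : ℕ) (p : unitInterval) : 0 ≤ expectedOverlap k n p := by
  unfold expectedOverlap
  have := p.2.1
  refine mul_nonneg (by positivity) (Finset.sum_nonneg fun y _ =>
    mul_nonneg (graphWeight_nonneg _ _ _) (div_nonneg ?_ (by positivity)))
  exact Finset.sum_nonneg fun S _ => Finset.sum_nonneg fun T _ => overlap_nonneg S T

theorem sum_sum_const_cliqueSets {k n : ℕ} (y : SimpleGraph (Fin n)) (c : ℝ) :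
    ∑ _S ∈ cliqueSets k y, ∑ _T ∈ cliqueSets k y, c = c * (#(cliqueSets k y) : ℝ) ^ 2 := by
  simp only [Finset.sum_const, nsmul_eq_mul]
  ring

theorem sum_graphWeight_mul_sum_sum_le {k n : ℕ} (hkn : k ≤ n) {p : unitInterval}
    (hp : 0 < (p : ℝ)) {F : ℕ → ℝ} (hF : ∀ l, 0 ≤ F l) :
    ∑ y : SimpleGraph (Fin n), graphWeight n p y *
        ∑ S ∈ cliqueSets k y, ∑ T ∈ cliqueSets k y, F #(S ∩ T)
      ≤ (n.choose k * (p : ℝ) ^ k.choose 2) ^ 2 *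
        ∑ l ∈ Finset.range (k + 1), interWeight n k l * (F l * ((p : ℝ) ^ l.choose 2)⁻¹) := by
  rw [sum_graphWeight_mul_sum_sum_cliqueSets hp (fun S T => F #(S ∩ T)), mul_pow,
    mul_comm ((n.choose k : ℝ) ^ 2), mul_assoc]
  refine mul_le_mul_of_nonneg_left ?_ (by positivity)
  exact sum_sum_card_inter_le hkn (F := fun l => F l * ((p : ℝ) ^ l.choose 2)⁻¹)
    (fun l => mul_nonneg (hF l) (by positivity))

/-- The variance of `X / m`: edge-disjoint pairs are uncorrelated, so only intersections of at least
two vertices count. -/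
theorem sum_graphWeight_mul_sq_sub_one_le {k n : ℕ} (hkn : k ≤ n) {p : unitInterval}
    (hp : 0 < (p : ℝ)) :
    ∑ y : SimpleGraph (Fin n), graphWeight n p y *
        (#(cliqueSets k y) / (n.choose k * (p : ℝ) ^ k.choose 2) - 1) ^ 2
      ≤ ∑ l ∈ Finset.range (k + 1), interWeight n k l *
          ((if 2 ≤ l then 1 else 0) * ((p : ℝ) ^ l.choose 2)⁻¹) := by
  have hM : (0 : ℝ) < n.choose k := by exact_mod_cast Nat.choose_pos hkn
  have hq : (0 : ℝ) < (p : ℝ) ^ k.choose 2 := pow_pos hp _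
  set m : ℝ := n.choose k * (p : ℝ) ^ k.choose 2 with hm
  have hm0 : 0 < m := mul_pos hM hq
  have h1 := sum_graphWeight_mul_sum_sum_cliqueSets (k := k) (n := n) hp (fun _ _ => 1)
  simp only [sum_sum_const_cliqueSets, one_mul] at h1
  have h2 := sum_graphWeight_mul_card_cliqueSets (k := k) (n := n) p
  have h3 := sum_graphWeight n p
  have hexp : ∑ y : SimpleGraph (Fin n), graphWeight n p y * (#(cliqueSets k y) / m - 1) ^ 2
      = (∑ y : SimpleGraph (Fin n), graphWeight n p y * (#(cliqueSets k y) : ℝ) ^ 2) / m ^ 2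
        - 2 * (∑ y : SimpleGraph (Fin n), graphWeight n p y * #(cliqueSets k y)) / m
        + ∑ y : SimpleGraph (Fin n), graphWeight n p y := by
    rw [Finset.sum_div, Finset.mul_sum, Finset.sum_div, ← Finset.sum_sub_distrib,
      ← Finset.sum_add_distrib]
    refine Finset.sum_congr rfl fun y _ => ?_
    field_simp
    ring
  have hcard : ∑ _S ∈ (Finset.univ : Finset (Fin n)).powersetCard k,
      ∑ _T ∈ (Finset.univ : Finset (Fin n)).powersetCard k, (1 : ℝ) = (n.choose k : ℝ) ^ 2 := by
    simp only [Finset.sum_const, Finset.card_powersetCard, Finset.card_univ, Fintype.card_fin,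
      nsmul_eq_mul, mul_one]
    ring
  -- Pairs with `l ≤ 1` have `p` to the power zero and contribute at most the squared mean, which
  -- cancels in the variance.
  have hle : ∑ S ∈ (Finset.univ : Finset (Fin n)).powersetCard k,
      ∑ T ∈ (Finset.univ : Finset (Fin n)).powersetCard k, ((p : ℝ) ^ (#(S ∩ T)).choose 2)⁻¹
      ≤ (n.choose k : ℝ) ^ 2 + (n.choose k : ℝ) ^ 2 *
        ∑ l ∈ Finset.range (k + 1), interWeight n k l *
          ((if 2 ≤ l then 1 else 0) * ((p : ℝ) ^ l.choose 2)⁻¹) := by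
    refine le_trans ?_ (add_le_add_right (sum_sum_card_inter_le hkn
      (F := fun l => (if 2 ≤ l then 1 else 0) * ((p : ℝ) ^ l.choose 2)⁻¹)
      (fun l => by positivity)) _)
    rw [← hcard, ← Finset.sum_add_distrib]
    refine Finset.sum_le_sum fun S _ => ?_
    rw [← Finset.sum_add_distrib]
    refine Finset.sum_le_sum fun T _ => ?_
    split_ifs with h
    · linarith
    · rw [Nat.choose_eq_zero_of_lt (by omega)]
      simp
  rw [hexp, h1, h2, h3]
  have h4 : ((p : ℝ) ^ k.choose 2) ^ 2 * (∑ S ∈ (Finset.univ : Finset (Fin n)).powersetCard k,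
      ∑ T ∈ (Finset.univ : Finset (Fin n)).powersetCard k, ((p : ℝ) ^ (#(S ∩ T)).choose 2)⁻¹) / m ^ 2
      ≤ 1 + ∑ l ∈ Finset.range (k + 1), interWeight n k l *
          ((if 2 ≤ l then 1 else 0) * ((p : ℝ) ^ l.choose 2)⁻¹) := by
    rw [div_le_iff₀ (by positivity), hm]
    refine (mul_le_mul_of_nonneg_left hle (by positivity)).trans_eq ?_
    ring
  rw [← hm, mul_div_assoc 2, div_self hm0.ne']
  linarith

/-- The random denominator `X` is replaced by `m` at the cost of the variance of `X / m`. The pair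
sum and the variance each cost twice the same series, hence the factor 4. -/
theorem expectedOverlap_le {k n : ℕ} (hkn : k ≤ n) {p : unitInterval}
    (hp : 0 < (p : ℝ)) :
    expectedOverlap k n p ≤ 4 * ∑ l ∈ Finset.range (k + 1), interWeight n k l *
          ((if 2 ≤ l then 1 else 0) * ((p : ℝ) ^ l.choose 2)⁻¹) := by
  have hM : (0 : ℝ) < n.choose k := by exact_mod_cast Nat.choose_pos hkn
  have hq : (0 : ℝ) < (p : ℝ) ^ k.choose 2 := pow_pos hp _
  have hvar := sum_graphWeight_mul_sq_sub_one_le hkn hp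
  have hpair := sum_graphWeight_mul_sum_sum_le hkn hp (F := fun l => if 2 ≤ l then 1 else 0)
    (fun l => by positivity)
  rw [expectedOverlap]
  set m : ℝ := n.choose k * (p : ℝ) ^ k.choose 2 with hm
  have hm0 : 0 < m := mul_pos hM hq
  set B := ∑ l ∈ Finset.range (k + 1), interWeight n k l *
          ((if 2 ≤ l then 1 else 0) * ((p : ℝ) ^ l.choose 2)⁻¹) with hB
  have hpt : ∀ y : SimpleGraph (Fin n), m⁻¹ * (graphWeight n p y *
      ((∑ S ∈ cliqueSets k y, ∑ T ∈ cliqueSets k y, overlap k S T) / #(cliqueSets k y)))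
      ≤ 2 / m ^ 2 * (graphWeight n p y * ∑ S ∈ cliqueSets k y, ∑ T ∈ cliqueSets k y,
          (if 2 ≤ #(S ∩ T) then 1 else 0))
        + 2 * (graphWeight n p y * (#(cliqueSets k y) / m - 1) ^ 2) := by
    intro y
    have hover : ∑ S ∈ cliqueSets k y, ∑ T ∈ cliqueSets k y, overlap k S T
        ≤ ∑ S ∈ cliqueSets k y, ∑ T ∈ cliqueSets k y, (if 2 ≤ #(S ∩ T) then 1 else 0) := by
      refine Finset.sum_le_sum fun S hS => Finset.sum_le_sum fun T _ => ?_
      split_ifs with h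
      · exact overlap_le_one (card_of_mem_cliqueSets hS) T
      · rw [overlap, Nat.choose_eq_zero_of_lt (by omega)]
        simp
    have hsq : ∑ S ∈ cliqueSets k y, ∑ T ∈ cliqueSets k y, overlap k S T
        ≤ (#(cliqueSets k y) : ℝ) ^ 2 := by
      rw [← one_mul ((#(cliqueSets k y) : ℝ) ^ 2), ← sum_sum_const_cliqueSets]
      exact Finset.sum_le_sum fun S hS => Finset.sum_le_sum fun T _ =>
        overlap_le_one (card_of_mem_cliqueSets hS) T
    have h0 : 0 ≤ ∑ S ∈ cliqueSets k y, ∑ T ∈ cliqueSets k y, overlap k S T :=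
      Finset.sum_nonneg fun S _ => Finset.sum_nonneg fun T _ => overlap_nonneg S T
    set W := ∑ S ∈ cliqueSets k y, ∑ T ∈ cliqueSets k y, overlap k S T
    set W' : ℝ := ∑ S ∈ cliqueSets k y, ∑ T ∈ cliqueSets k y, (if 2 ≤ #(S ∩ T) then 1 else 0)
    set X : ℝ := (#(cliqueSets k y) : ℝ) with hX
    have hX0 : 0 ≤ X := Nat.cast_nonneg _
    have hQ := graphWeight_nonneg n p y
    -- If `X ≥ m / 2`, the pair sum alone suffices. Otherwise the left side is at most `X / m < 1 /
    -- 2`, while the deviation term exceeds `1 / 2`.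
    have hmain : m⁻¹ * (W / X) ≤ 2 / m ^ 2 * W' + 2 * (X / m - 1) ^ 2 := by
      rcases le_or_gt (m / 2) X with h | h
      · have hXpos : 0 < X := by linarith
        have h5 : m⁻¹ * (W / X) ≤ 2 / m ^ 2 * W := by
          rw [inv_mul_eq_div, div_div, div_mul_eq_mul_div, div_le_div_iff₀ (by positivity)
            (by positivity)]
          nlinarith [mul_nonneg (mul_nonneg h0 hm0.le) (sub_nonneg.2 h)]
        have h6 : 2 / m ^ 2 * W ≤ 2 / m ^ 2 * W' := mul_le_mul_of_nonneg_left hover (by positivity)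
        nlinarith [sq_nonneg (X / m - 1)]
      · have h5 : W / X ≤ X := div_le_of_le_mul₀ hX0 hX0 (by linarith [sq X])
        have h6 : m⁻¹ * (W / X) ≤ X / m := by
          rw [inv_mul_eq_div]
          exact div_le_div_of_nonneg_right h5 hm0.le
        have h7 : X / m < 1 / 2 := by
          rw [div_lt_iff₀ hm0]
          linarith
        have h8 : 0 ≤ 2 / m ^ 2 * W' := mul_nonneg (by positivity) (h0.trans hover)
        nlinarith
    calc m⁻¹ * (graphWeight n p y * (W / X))
        = graphWeight n p y * (m⁻¹ * (W / X)) := by ring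
      _ ≤ graphWeight n p y * (2 / m ^ 2 * W' + 2 * (X / m - 1) ^ 2) :=
          mul_le_mul_of_nonneg_left hmain hQ
      _ = _ := by ring
  rw [Finset.mul_sum]
  refine (Finset.sum_le_sum fun y _ => hpt y).trans ?_
  rw [Finset.sum_add_distrib, ← Finset.mul_sum, ← Finset.mul_sum]
  have h9 : 2 / m ^ 2 * ∑ y : SimpleGraph (Fin n), graphWeight n p y *
      ∑ S ∈ cliqueSets k y, ∑ T ∈ cliqueSets k y, (if 2 ≤ #(S ∩ T) then (1 : ℝ) else 0) ≤ 2 * B := by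
    refine (mul_le_mul_of_nonneg_left hpair (by positivity)).trans_eq ?_
    field_simp
  linarith

theorem one_sub_expectedOverlap_eq {k n : ℕ} (hkn : k ≤ n) {p : unitInterval}
    (hp : 0 < (p : ℝ)) :
    1 - expectedOverlap k n p = (n.choose k * (p : ℝ) ^ k.choose 2)⁻¹ *
      ∑ y : SimpleGraph (Fin n), graphWeight n p y * (#(cliqueSets k y) -
        (∑ S ∈ cliqueSets k y, ∑ T ∈ cliqueSets k y, overlap k S T) / #(cliqueSets k y)) := by
  have hM : (0 : ℝ) < n.choose k := by exact_mod_cast Nat.choose_pos hkn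
  have hq : (0 : ℝ) < (p : ℝ) ^ k.choose 2 := pow_pos hp _
  simp_rw [mul_sub]
  rw [Finset.sum_sub_distrib, sum_graphWeight_mul_card_cliqueSets, mul_sub,
    inv_mul_cancel₀ (mul_pos hM hq).ne', expectedOverlap]

/-- Each pair loses at most `δ` unless its overlap is below `1 - δ`. Such exceptional pairs are
simply counted, dropping the division by `X`, which is harmless as `X ≥ 1` where it matters. -/
theorem one_sub_expectedOverlap_le {k n : ℕ} (hk : 2 ≤ k) (hkn : k ≤ n) {p : unitInterval}
    (hp : 0 < (p : ℝ)) {δ : ℝ} (hδ : 0 ≤ δ) :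
    1 - expectedOverlap k n p ≤ δ + (n.choose k * (p : ℝ) ^ k.choose 2) *
      ∑ l ∈ Finset.range (k + 1), interWeight n k l *
        ((if (l.choose 2 : ℝ) < (1 - δ) * k.choose 2 then 1 else 0)
          * ((p : ℝ) ^ l.choose 2)⁻¹) := by
  have hM : (0 : ℝ) < n.choose k := by exact_mod_cast Nat.choose_pos hkn
  have hq : (0 : ℝ) < (p : ℝ) ^ k.choose 2 := pow_pos hp _
  have hN : (0 : ℝ) < k.choose 2 := by exact_mod_cast Nat.choose_pos hk
  have hpair := sum_graphWeight_mul_sum_sum_le hkn hp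
    (F := fun l => if (l.choose 2 : ℝ) < (1 - δ) * k.choose 2 then 1 else 0)
    (fun l => by positivity)
  have hcard := sum_graphWeight_mul_card_cliqueSets (k := k) (n := n) p
  rw [one_sub_expectedOverlap_eq hkn hp]
  set m : ℝ := n.choose k * (p : ℝ) ^ k.choose 2 with hm
  have hm0 : 0 < m := mul_pos hM hq
  have hpt : ∀ y : SimpleGraph (Fin n), graphWeight n p y * (#(cliqueSets k y) -
        (∑ S ∈ cliqueSets k y, ∑ T ∈ cliqueSets k y, overlap k S T) / #(cliqueSets k y))
      ≤ δ * (graphWeight n p y * #(cliqueSets k y)) + graphWeight n p y *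
        ∑ S ∈ cliqueSets k y, ∑ T ∈ cliqueSets k y,
          (if ((#(S ∩ T)).choose 2 : ℝ) < (1 - δ) * k.choose 2 then 1 else 0) := by
    intro y
    have hover : (#(cliqueSets k y) : ℝ) ^ 2
        - ∑ S ∈ cliqueSets k y, ∑ T ∈ cliqueSets k y, overlap k S T
        ≤ δ * (#(cliqueSets k y) : ℝ) ^ 2 + ∑ S ∈ cliqueSets k y, ∑ T ∈ cliqueSets k y,
          (if ((#(S ∩ T)).choose 2 : ℝ) < (1 - δ) * k.choose 2 then (1 : ℝ) else 0) := by
      rw [sub_le_iff_le_add]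
      have h1 := sum_sum_const_cliqueSets (k := k) y 1
      rw [one_mul] at h1
      rw [← h1, h1, ← sum_sum_const_cliqueSets, ← h1]
      simp_rw [← Finset.sum_add_distrib]
      refine Finset.sum_le_sum fun S _ => Finset.sum_le_sum fun T _ => ?_
      have h0 := overlap_nonneg (k := k) S T
      split_ifs with h
      · linarith
      · have h2 : 1 - δ ≤ overlap k S T := by
          rw [overlap, le_div_iff₀ hN]
          linarith
        linarith
    have h0 : (0 : ℝ) ≤ ∑ S ∈ cliqueSets k y, ∑ T ∈ cliqueSets k y,
          (if ((#(S ∩ T)).choose 2 : ℝ) < (1 - δ) * k.choose 2 then (1 : ℝ) else 0) := by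
      exact Finset.sum_nonneg fun S _ => Finset.sum_nonneg fun T _ => by positivity
    set W := ∑ S ∈ cliqueSets k y, ∑ T ∈ cliqueSets k y, overlap k S T
    set W' := ∑ S ∈ cliqueSets k y, ∑ T ∈ cliqueSets k y,
          (if ((#(S ∩ T)).choose 2 : ℝ) < (1 - δ) * k.choose 2 then (1 : ℝ) else 0)
    have hmain : (#(cliqueSets k y) : ℝ) - W / #(cliqueSets k y)
        ≤ δ * #(cliqueSets k y) + W' := by
      rcases Nat.eq_zero_or_pos #(cliqueSets k y) with h | h
      · rw [h]
        simpa using h0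
      · have hX : (1 : ℝ) ≤ #(cliqueSets k y) := by exact_mod_cast h
        rw [sub_le_iff_le_add, ← mul_le_mul_iff_left₀ (by linarith : (0 : ℝ) < #(cliqueSets k y)),
          add_mul, div_mul_cancel₀ _ (by linarith)]
        nlinarith
    calc _ ≤ graphWeight n p y * (δ * #(cliqueSets k y) + W') :=
          mul_le_mul_of_nonneg_left hmain (graphWeight_nonneg n p y)
      _ = _ := by ring
  have hsum := Finset.sum_le_sum fun (y : SimpleGraph (Fin n)) (_ : y ∈ Finset.univ) => hpt y
  rw [Finset.sum_add_distrib, ← Finset.mul_sum, hcard] at hsum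
  refine (mul_le_mul_of_nonneg_left (hsum.trans (add_le_add_right hpair _))
    (inv_nonneg.2 hm0.le)).trans_eq ?_
  field_simp

/-- Distinct cliques differ in at least one of their `N` edges, so a graph with `X ≥ 1` cliques
contributes at least `(X - 1) / N`; for `X = 0` this bound is negative. -/
theorem le_one_sub_expectedOverlap {k n : ℕ} (hk : 2 ≤ k) (hkn : k ≤ n) {p : unitInterval}
    (hp : 0 < (p : ℝ)) :
    1 / (k.choose 2 : ℝ) * (1 - 1 / (n.choose k * (p : ℝ) ^ k.choose 2))
      ≤ 1 - expectedOverlap k n p := by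
  have hM : (0 : ℝ) < n.choose k := by exact_mod_cast Nat.choose_pos hkn
  have hq : (0 : ℝ) < (p : ℝ) ^ k.choose 2 := pow_pos hp _
  have hN : (0 : ℝ) < k.choose 2 := by exact_mod_cast Nat.choose_pos hk
  have hcard := sum_graphWeight_mul_card_cliqueSets (k := k) (n := n) p
  rw [one_sub_expectedOverlap_eq hkn hp]
  set m : ℝ := n.choose k * (p : ℝ) ^ k.choose 2 with hm
  have hm0 : 0 < m := mul_pos hM hq
  have hpt : ∀ y : SimpleGraph (Fin n),
      1 / (k.choose 2 : ℝ) * (graphWeight n p y * #(cliqueSets k y) - graphWeight n p y)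
      ≤ graphWeight n p y * (#(cliqueSets k y) -
        (∑ S ∈ cliqueSets k y, ∑ T ∈ cliqueSets k y, overlap k S T) / #(cliqueSets k y)) := by
    intro y
    have hmain : 1 / (k.choose 2 : ℝ) * (#(cliqueSets k y) - 1) ≤ #(cliqueSets k y) -
        (∑ S ∈ cliqueSets k y, ∑ T ∈ cliqueSets k y, overlap k S T) / #(cliqueSets k y) := by
      rcases Nat.eq_zero_or_pos #(cliqueSets k y) with h | h
      · rw [h]
        simp
      · have hX : (0 : ℝ) < #(cliqueSets k y) := by exact_mod_cast h
        have hover : ∑ S ∈ cliqueSets k y, ∑ T ∈ cliqueSets k y, overlap k S T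
            ≤ ∑ S ∈ cliqueSets k y, ∑ T ∈ cliqueSets k y,
              ((1 - 1 / (k.choose 2 : ℝ)) + if S = T then 1 / (k.choose 2 : ℝ) else 0) := by
          refine Finset.sum_le_sum fun S hS => Finset.sum_le_sum fun T hT => ?_
          split_ifs with hST
          · subst hST
            rw [sub_add_cancel]
            exact overlap_le_one (card_of_mem_cliqueSets hS) S
          · rw [add_zero]
            exact overlap_of_ne hk (card_of_mem_cliqueSets hS) (card_of_mem_cliqueSets hT) hST
        have hdiag : ∑ S ∈ cliqueSets k y, ∑ T ∈ cliqueSets k y,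
            (if S = T then 1 / (k.choose 2 : ℝ) else 0)
            = #(cliqueSets k y) * (1 / (k.choose 2 : ℝ)) := by
          rw [← nsmul_eq_mul, ← Finset.sum_const]
          refine Finset.sum_congr rfl fun S hS => ?_
          rw [Finset.sum_ite_eq, if_pos hS]
        simp_rw [Finset.sum_add_distrib] at hover
        rw [hdiag, sum_sum_const_cliqueSets] at hover
        rw [le_sub_comm, div_le_iff₀ hX]
        refine hover.trans_eq ?_
        ring
    calc _ = graphWeight n p y * (1 / (k.choose 2 : ℝ) * (#(cliqueSets k y) - 1)) := by ring
      _ ≤ _ := mul_le_mul_of_nonneg_left hmain (graphWeight_nonneg n p y)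
  have hsum := Finset.sum_le_sum fun (y : SimpleGraph (Fin n)) (_ : y ∈ Finset.univ) => hpt y
  rw [← Finset.mul_sum, Finset.sum_sub_distrib, hcard, sum_graphWeight] at hsum
  refine Eq.trans_le ?_ (mul_le_mul_of_nonneg_left hsum (inv_nonneg.2 hm0.le))
  field_simp

/-- The diagonal pairs alone make `W / X ≥ 1` whenever `X ≥ 1`, where `W` is the sum of the
overlaps. Since `(1 - X / D)² ≥ 0`, this is at least `2X/D - X²/D²`, whose mean is controlled by the
second moment `E X² ≤ m D`. -/
theorem le_expectedOverlap {k n : ℕ} (hk : 2 ≤ k) (hkn : k ≤ n) {p : unitInterval}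
    (hp : 0 < (p : ℝ)) {D : ℝ} (hD : 0 < D)
    (h : n.choose k * (p : ℝ) ^ k.choose 2 * ∑ l ∈ Finset.range (k + 1),
      interWeight n k l * ((p : ℝ) ^ l.choose 2)⁻¹ ≤ D) :
    1 / D ≤ expectedOverlap k n p := by
  have hM : (0 : ℝ) < n.choose k := by exact_mod_cast Nat.choose_pos hkn
  have hq : (0 : ℝ) < (p : ℝ) ^ k.choose 2 := pow_pos hp _
  have hcard := sum_graphWeight_mul_card_cliqueSets (k := k) (n := n) p
  have hpair := sum_graphWeight_mul_sum_sum_le hkn hp (F := fun _ => 1) (fun _ => zero_le_one)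
  simp only [sum_sum_const_cliqueSets, one_mul] at hpair
  rw [expectedOverlap]
  set m : ℝ := n.choose k * (p : ℝ) ^ k.choose 2 with hm
  have hm0 : 0 < m := mul_pos hM hq
  have hpt : ∀ y : SimpleGraph (Fin n),
      2 / D * (graphWeight n p y * #(cliqueSets k y))
        - 1 / D ^ 2 * (graphWeight n p y * (#(cliqueSets k y) : ℝ) ^ 2)
      ≤ graphWeight n p y *
        ((∑ S ∈ cliqueSets k y, ∑ T ∈ cliqueSets k y, overlap k S T) / #(cliqueSets k y)) := by
    intro y
    have hmain : 2 / D * #(cliqueSets k y) - 1 / D ^ 2 * (#(cliqueSets k y) : ℝ) ^ 2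
        ≤ (∑ S ∈ cliqueSets k y, ∑ T ∈ cliqueSets k y, overlap k S T) / #(cliqueSets k y) := by
      rcases Nat.eq_zero_or_pos #(cliqueSets k y) with h | h
      · rw [h]
        simp
      · have hX : (0 : ℝ) < #(cliqueSets k y) := by exact_mod_cast h
        have hover : (#(cliqueSets k y) : ℝ)
            ≤ ∑ S ∈ cliqueSets k y, ∑ T ∈ cliqueSets k y, overlap k S T := by
          rw [Finset.card_eq_sum_ones, Nat.cast_sum]
          refine Finset.sum_le_sum fun S hS => ?_
          rw [Nat.cast_one, ← overlap_self hk (card_of_mem_cliqueSets hS)]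
          exact Finset.single_le_sum (f := fun T => overlap k S T)
            (fun T _ => overlap_nonneg S T) hS
        have h1 : 1 ≤ (∑ S ∈ cliqueSets k y, ∑ T ∈ cliqueSets k y, overlap k S T)
            / #(cliqueSets k y) := by
          rwa [one_le_div hX]
        have h2 : 1 - (2 / D * #(cliqueSets k y) - 1 / D ^ 2 * (#(cliqueSets k y) : ℝ) ^ 2)
            = (1 - #(cliqueSets k y) / D) ^ 2 := by
          field_simp
          ring
        linarith [sq_nonneg (1 - #(cliqueSets k y) / D)]
    calc _ = graphWeight n p y *
          (2 / D * #(cliqueSets k y) - 1 / D ^ 2 * (#(cliqueSets k y) : ℝ) ^ 2) := by ring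
      _ ≤ _ := mul_le_mul_of_nonneg_left hmain (graphWeight_nonneg n p y)
  have hsum := Finset.sum_le_sum fun (y : SimpleGraph (Fin n)) (_ : y ∈ Finset.univ) => hpt y
  rw [Finset.sum_sub_distrib, ← Finset.mul_sum, ← Finset.mul_sum, hcard] at hsum
  refine le_trans ?_ (mul_le_mul_of_nonneg_left hsum (inv_nonneg.2 hm0.le))
  set V := ∑ y : SimpleGraph (Fin n), graphWeight n p y * (#(cliqueSets k y) : ℝ) ^ 2
  have hV : V ≤ m * D := by
    refine hpair.trans ?_
    rw [sq, mul_assoc]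
    exact mul_le_mul_of_nonneg_left h hm0.le
  have hV' : m⁻¹ * (1 / D ^ 2 * V) ≤ 1 / D := by
    refine (mul_le_mul_of_nonneg_left (mul_le_mul_of_nonneg_left hV (by positivity))
      (inv_nonneg.2 hm0.le)).trans_eq ?_
    field_simp
  have h2 : m⁻¹ * (2 / D * m) = 2 / D := by field_simp
  have h3 : 2 / D = 1 / D + 1 / D := by ring
  rw [mul_sub, h2]
  linarith

/-! ### The first moment threshold -/

/-- A subgraph isomorphic to a complete graph is determined by its vertex set. Copies are counted as
subgraphs, so no factor `k!` appears. -/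
theorem copyCount_top_eq {k n : ℕ} (y : SimpleGraph (Fin n)) :
    y.copyCount (⊤ : SimpleGraph (Fin k)) = #(cliqueSets k y) := by
  classical
  have hadj : ∀ (G' : y.Subgraph), Nonempty ((⊤ : SimpleGraph (Fin k)) ≃g G'.coe) →
      ∀ a b, G'.Adj a b ↔ a ∈ G'.verts ∧ b ∈ G'.verts ∧ a ≠ b := by
    rintro G' ⟨e⟩ a b
    refine ⟨fun h => ⟨h.fst_mem, h.snd_mem, h.ne⟩, fun ⟨ha, hb, hab⟩ => ?_⟩
    have h : G'.coe.Adj ⟨a, ha⟩ ⟨b, hb⟩ := by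
      rw [← e.symm.map_adj_iff, SimpleGraph.top_adj]
      exact fun h => hab (congrArg Subtype.val (e.symm.injective h))
    exact h
  rw [SimpleGraph.copyCount, cliqueSets]
  refine Finset.card_bij (fun G' _ => G'.verts.toFinset) ?_ ?_ ?_
  · intro G' hG'
    simp only [Finset.mem_filter, Finset.mem_univ, true_and] at hG'
    rw [Finset.mem_filter, Finset.mem_powersetCard_univ]
    constructor
    · obtain ⟨e⟩ := hG'
      rw [Set.toFinset_card, ← Fintype.card_congr e.toEquiv, Fintype.card_fin]
    · intro a b hab
      simp only [cliqueOn, Set.mem_toFinset] at hab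
      exact G'.adj_sub ((hadj G' hG' a b).2 hab)
  · intro G₁ h₁ G₂ h₂ h
    simp only [Finset.mem_filter, Finset.mem_univ, true_and] at h₁ h₂
    have hv : G₁.verts = G₂.verts := by simpa using h
    refine SimpleGraph.Subgraph.ext hv ?_
    ext a b
    rw [hadj G₁ h₁, hadj G₂ h₂, hv]
  · intro S hS
    rw [Finset.mem_filter, Finset.mem_powersetCard_univ] at hS
    let G' : y.Subgraph :=
      { verts := S
        Adj := (cliqueOn S).Adj
        adj_sub := fun h => hS.2 h
        edge_vert := fun h => h.1
        symm := (cliqueOn S).symm }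
    refine ⟨G', ?_, by simp [G']⟩
    simp only [Finset.mem_filter, Finset.mem_univ, true_and]
    have e : Fin k ≃ G'.verts := (Fintype.equivFinOfCardEq (by simp [G', hS.1])).symm
    refine ⟨⟨e, ?_⟩⟩
    intro a b
    simp only [SimpleGraph.Subgraph.coe_adj, SimpleGraph.top_adj]
    constructor
    · rintro h rfl
      exact h.2.2 rfl
    · exact fun h => ⟨(e a).2, (e b).2, fun h' => h (e.injective (Subtype.ext h'))⟩

theorem expectedCopies_top (k n : ℕ) (p : unitInterval) :
    expectedCopies (⊤ : SimpleGraph (Fin k)) n p = n.choose k * (p : ℝ) ^ k.choose 2 := by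
  rw [expectedCopies, integral_binomialRandom]
  simp_rw [copyCount_top_eq]
  exact sum_graphWeight_mul_card_cliqueSets p

/-- The critical probability, at which the expected number of `k`-cliques is one. -/
noncomputable def cliqueThreshold (n k : ℕ) : ℝ :=
  (n.choose k : ℝ) ^ (-(1 : ℝ) / (k.choose 2 : ℝ))

section Threshold

variable {n k : ℕ}

theorem cliqueThreshold_pos (hkn : k ≤ n) : 0 < cliqueThreshold n k := by
  have hM : (0 : ℝ) < n.choose k := by exact_mod_cast Nat.choose_pos hkn
  exact Real.rpow_pos_of_pos hM _

theorem cliqueThreshold_le_one (hkn : k ≤ n) : cliqueThreshold n k ≤ 1 := by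
  have hM : (1 : ℝ) ≤ n.choose k := by exact_mod_cast Nat.choose_pos hkn
  refine Real.rpow_le_one_of_one_le_of_nonpos hM ?_
  rw [neg_div]
  exact neg_nonpos.2 (by positivity)

theorem inv_cliqueThreshold_pow (j : ℕ) :
    (cliqueThreshold n k ^ j)⁻¹ = (n.choose k : ℝ) ^ ((j : ℝ) / (k.choose 2 : ℝ)) := by
  have hM : (0 : ℝ) ≤ n.choose k := Nat.cast_nonneg _
  rw [cliqueThreshold, ← Real.rpow_mul_natCast hM, ← Real.rpow_neg hM]
  congr 1
  ring

theorem choose_mul_cliqueThreshold_pow (hk : 2 ≤ k) (hkn : k ≤ n) :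
    (n.choose k : ℝ) * cliqueThreshold n k ^ k.choose 2 = 1 := by
  have hN : (k.choose 2 : ℝ) ≠ 0 := by exact_mod_cast (Nat.choose_pos hk).ne'
  have h := inv_cliqueThreshold_pow (n := n) (k := k) (k.choose 2)
  rw [div_self hN, Real.rpow_one] at h
  rw [← h, inv_mul_cancel₀ (pow_pos (cliqueThreshold_pos hkn) _).ne']

theorem firstMomentThreshold_top (hk : 2 ≤ k) (hkn : k ≤ n) :
    firstMomentThreshold (⊤ : SimpleGraph (Fin k)) n = cliqueThreshold n k := by
  have hM : (0 : ℝ) < n.choose k := by exact_mod_cast Nat.choose_pos hkn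
  have h1 := choose_mul_cliqueThreshold_pow hk hkn
  refine IsLeast.csInf_eq ⟨⟨⟨cliqueThreshold n k, (cliqueThreshold_pos hkn).le,
    cliqueThreshold_le_one hkn⟩, rfl, ?_⟩, ?_⟩
  · rw [expectedCopies_top, h1]
  · rintro x ⟨p, rfl, hp⟩
    rw [expectedCopies_top, ← h1] at hp
    exact le_of_pow_le_pow_left₀ (Nat.choose_pos hk).ne' p.2.1 (le_of_mul_le_mul_left hp hM)

/-! ### Estimates at the threshold -/

theorem pow_le_choose_mul_self_pow (l : ℕ) : ∀ n : ℕ, l ≤ n → n ^ l ≤ n.choose l * l ^ l := by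
  induction l with
  | zero => simp
  | succ l ih =>
    intro n hn
    obtain ⟨n, rfl⟩ : ∃ j, n = j + 1 := ⟨n - 1, by omega⟩
    have hln : l ≤ n := by omega
    have h1 : (n + 1) ^ l ≤ n.choose l * (l + 1) ^ l := by
      rcases Nat.eq_zero_or_pos l with rfl | hl
      · simp
      · refine le_of_mul_le_mul_right (a := l ^ l) ?_ (Nat.pow_pos hl)
        calc (n + 1) ^ l * l ^ l = ((n + 1) * l) ^ l := (mul_pow _ _ _).symm
          -- This is `(n + 1) l ≤ n (l + 1)`, that is, `l ≤ n`.
          _ ≤ (n * (l + 1)) ^ l := Nat.pow_le_pow_left (by nlinarith) l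
          _ = n ^ l * (l + 1) ^ l := mul_pow _ _ _
          _ ≤ n.choose l * l ^ l * (l + 1) ^ l := Nat.mul_le_mul_right _ (ih n hln)
          _ = n.choose l * (l + 1) ^ l * l ^ l := by ring
    have h2 := Nat.add_one_mul_choose_eq n l
    calc (n + 1) ^ (l + 1) = (n + 1) * (n + 1) ^ l := by ring
      _ ≤ (n + 1) * (n.choose l * (l + 1) ^ l) := Nat.mul_le_mul_left _ h1
      _ = (n + 1) * n.choose l * (l + 1) ^ l := by ring
      _ = _ := by rw [h2]; ring

theorem pow_le_choose_mul_pow {l : ℕ} (hlk : l ≤ k) (hkn : k ≤ n) :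
    (n : ℝ) ^ l ≤ n.choose l * (k : ℝ) ^ l := by
  have h1 := pow_le_choose_mul_self_pow l n (hlk.trans hkn)
  have h2 : n ^ l ≤ n.choose l * k ^ l :=
    h1.trans (Nat.mul_le_mul_left _ (Nat.pow_le_pow_left hlk l))
  exact_mod_cast h2

/-- The usual bound `(e n / k)^k`, with `e` rounded up to 3. -/
theorem choose_le_three_mul_div_pow (hk : 0 < k) :
    (n.choose k : ℝ) ≤ (3 * n / k) ^ k := by
  have hk' : (0 : ℝ) < k := by exact_mod_cast hk
  have hf : (0 : ℝ) < k.factorial := by exact_mod_cast k.factorial_pos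
  have h1 : (n.choose k : ℝ) ≤ (n : ℝ) ^ k / k.factorial := Nat.choose_le_pow_div k n
  have h2 : (k : ℝ) ^ k / k.factorial ≤ Real.exp k :=
    Real.pow_div_factorial_le_exp _ (Nat.cast_nonneg k) k
  have h3 : Real.exp k ≤ 3 ^ k := by
    rw [← Real.exp_one_pow]
    exact pow_le_pow_left₀ (Real.exp_pos 1).le Real.exp_one_lt_three.le k
  rw [div_pow, le_div_iff₀ (by positivity), mul_pow]
  calc (n.choose k : ℝ) * (k : ℝ) ^ k ≤ (n : ℝ) ^ k / k.factorial * (k : ℝ) ^ k :=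
        mul_le_mul_of_nonneg_right h1 (by positivity)
    _ = (k : ℝ) ^ k / k.factorial * (n : ℝ) ^ k := by ring
    _ ≤ 3 ^ k * (n : ℝ) ^ k := mul_le_mul_of_nonneg_right (h2.trans h3) (by positivity)

theorem one_le_three_mul_div (hk : 2 ≤ k) (hkn : k ≤ n) : (1 : ℝ) ≤ 3 * n / k := by
  have hk' : (0 : ℝ) < k := by exact_mod_cast (by omega : 0 < k)
  have : (k : ℝ) ≤ n := by exact_mod_cast hkn
  rw [one_le_div hk']
  linarith

/-- At the threshold, `p^(-C(l,2))` is `M` to the power `l(l-1) / (k(k-1))`, and `M ≤ (3n/k)^k`. The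
parameter `t` bounds the resulting exponent `l(l-1)/(k-1)`; it is taken to be `l` in general and
`l/2` for small `l`. -/
theorem inv_cliqueThreshold_pow_le (hk : 2 ≤ k) (hkn : k ≤ n) {l : ℕ} {t : ℝ}
    (ht : (l : ℝ) * (l - 1) ≤ t * (k - 1)) :
    (cliqueThreshold n k ^ l.choose 2)⁻¹ ≤ (3 * n / k : ℝ) ^ t := by
  have hk' : (2 : ℝ) ≤ k := by exact_mod_cast hk
  have hu := one_le_three_mul_div hk hkn
  have hM : (0 : ℝ) ≤ n.choose k := Nat.cast_nonneg _
  rw [inv_cliqueThreshold_pow]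
  refine (Real.rpow_le_rpow hM (choose_le_three_mul_div_pow (by omega)) (by positivity)).trans ?_
  rw [← Real.rpow_natCast_mul (by linarith)]
  refine Real.rpow_le_rpow_of_exponent_le hu ?_
  rw [Nat.cast_choose_two, Nat.cast_choose_two, ← mul_div_assoc, div_le_iff₀ (by nlinarith)]
  nlinarith

/-- With `t = l`, the growth `(n/k)^l` is absorbed by `C(n,l)`. What remains is `C(k,l)² ≤ 4^k` and
`3^l ≤ 3^k`. -/
theorem interWeight_mul_inv_cliqueThreshold_pow_le (hk : 2 ≤ k) (hkn : k ≤ n) {l : ℕ}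
    (hlk : l ≤ k) :
    interWeight n k l * (cliqueThreshold n k ^ l.choose 2)⁻¹ ≤ 12 ^ k := by
  have hk' : (0 : ℝ) < k := by exact_mod_cast (by omega : 0 < k)
  have hn' : (0 : ℝ) < n := by exact_mod_cast (by omega : 0 < n)
  have hlk' : (l : ℝ) ≤ k := by exact_mod_cast hlk
  have hc : (0 : ℝ) < n.choose l := by exact_mod_cast Nat.choose_pos (hlk.trans hkn)
  have h1 := inv_cliqueThreshold_pow_le hk hkn (l := l) (t := l) (by
    have : (0 : ℝ) ≤ l := Nat.cast_nonneg l
    nlinarith)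
  rw [Real.rpow_natCast] at h1
  have h2 := pow_le_choose_mul_pow hlk hkn
  have h3 : (k.choose l : ℝ) ≤ 2 ^ k := by exact_mod_cast Nat.choose_le_two_pow k l
  have h4 : (3 * n / k : ℝ) ^ l ≤ 3 ^ k * n.choose l := by
    rw [div_pow, div_le_iff₀ (by positivity), mul_pow, mul_assoc]
    exact mul_le_mul (pow_le_pow_right₀ (by norm_num) hlk) h2 (by positivity) (by positivity)
  calc interWeight n k l * (cliqueThreshold n k ^ l.choose 2)⁻¹
      ≤ interWeight n k l * (3 ^ k * n.choose l) :=
        mul_le_mul_of_nonneg_left (h1.trans h4) (interWeight_nonneg _ _ _)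
    _ = (k.choose l : ℝ) ^ 2 * 3 ^ k := by
        rw [interWeight]
        field_simp
    _ ≤ (2 ^ k) ^ 2 * 3 ^ k := by gcongr
    _ = 12 ^ k := by
        rw [← pow_mul, mul_comm k 2, pow_mul, ← mul_pow]
        norm_num

/-- With `t = l/2`, only half of the power of `n/k` in `C(n,l)` is used up, and the other half is a
gain. -/
theorem interWeight_mul_inv_cliqueThreshold_pow_le_of_small (hk : 2 ≤ k) (hkn : k ≤ n) {l : ℕ}
    (hl : 2 * l ≤ k + 1) :
    interWeight n k l * (cliqueThreshold n k ^ l.choose 2)⁻¹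
      ≤ (3 * (k : ℝ) ^ 2 / √(3 * n / k)) ^ l := by
  have hk' : (2 : ℝ) ≤ k := by exact_mod_cast hk
  have hn' : (0 : ℝ) < n := by exact_mod_cast (by omega : 0 < n)
  have hlk : l ≤ k := by omega
  have hl' : 2 * (l : ℝ) ≤ k + 1 := by exact_mod_cast hl
  have hc : (0 : ℝ) < n.choose l := by exact_mod_cast Nat.choose_pos (hlk.trans hkn)
  have hu := one_le_three_mul_div hk hkn
  have h1 := inv_cliqueThreshold_pow_le hk hkn (l := l) (t := l / 2) (by
    have : (0 : ℝ) ≤ l := Nat.cast_nonneg l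
    nlinarith)
  have h0 : (3 * n / k : ℝ) ^ ((l : ℝ) / 2) = √(3 * n / k) ^ l := by
    rw [Real.sqrt_eq_rpow, ← Real.rpow_mul_natCast (by linarith)]
    congr 1
    ring
  rw [h0] at h1
  have h2 := pow_le_choose_mul_pow hlk hkn
  have h3 : (k.choose l : ℝ) ≤ (k : ℝ) ^ l := by exact_mod_cast Nat.choose_le_pow k l
  have hw : interWeight n k l ≤ ((k : ℝ) ^ 2 * (k / n)) ^ l := by
    rw [interWeight, div_le_iff₀ hc]
    calc (k.choose l : ℝ) ^ 2 ≤ ((k : ℝ) ^ l) ^ 2 := by gcongr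
      _ = ((k : ℝ) ^ 2) ^ l * (n : ℝ) ^ l * ((n : ℝ) ^ l)⁻¹ := by
          rw [mul_assoc, mul_inv_cancel₀ (by positivity), mul_one, ← pow_mul, ← pow_mul, mul_comm]
      _ ≤ ((k : ℝ) ^ 2) ^ l * (n.choose l * (k : ℝ) ^ l) * ((n : ℝ) ^ l)⁻¹ := by gcongr
      _ = _ := by
          rw [mul_pow, div_pow]
          ring
  refine (mul_le_mul hw h1 (inv_nonneg.2 (pow_nonneg (cliqueThreshold_pos hkn).le _))
    (by positivity)).trans_eq ?_
  rw [← mul_pow]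
  congr 1
  have hs : √(3 * n / k : ℝ) * √(3 * n / k : ℝ) = 3 * n / k := Real.mul_self_sqrt (by linarith)
  have hs0 : 0 < √(3 * n / k : ℝ) := Real.sqrt_pos.2 (by linarith)
  rw [eq_div_iff hs0.ne', mul_assoc, hs]
  field_simp

end Threshold

/-! ### Overlap bounds near the threshold -/

section Bounds

variable {n k : ℕ}

theorem two_mul_choose_two (j : ℕ) : (j + 1).choose 2 * 2 = (j + 1) * j := by
  have h := Nat.add_one_mul_choose_eq j 1
  rw [Nat.choose_one_right] at h
  exact h.symm

theorem sum_range_interWeight_mul_le {b : ℝ} {f : ℕ → ℝ}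
    (h : ∀ l ≤ k, interWeight n k l * f l ≤ b) :
    ∑ l ∈ Finset.range (k + 1), interWeight n k l * f l ≤ (k + 1) * b := by
  refine (Finset.sum_le_card_nsmul _ _ b fun l hl =>
    h l (Nat.lt_succ_iff.1 (Finset.mem_range.1 hl))).trans_eq ?_
  rw [Finset.card_range, nsmul_eq_mul]
  push_cast
  ring

/-- Above the threshold the expected overlap is small. -/
theorem expectedOverlap_le_of_threshold_le (hk : 2 ≤ k) (hkn : k ≤ n) {d : ℝ} (hd : 1 < d)
    {p : unitInterval} (hp : d ^ 8 * cliqueThreshold n k ≤ p)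
    (hsmall : 12 * (k : ℝ) ^ 2 / d ^ k ≤ 1) :
    expectedOverlap k n p ≤ 4 * ((k + 1) * (12 * (k : ℝ) ^ 2 / d ^ k)) := by
  have hd0 : 0 < d := by linarith
  have hk' : (2 : ℝ) ≤ k := by exact_mod_cast hk
  have hc := cliqueThreshold_pos hkn
  have hp0 : 0 < (p : ℝ) := lt_of_lt_of_le (by positivity) hp
  have hM : (0 : ℝ) < n.choose k := by exact_mod_cast Nat.choose_pos hkn
  obtain ⟨j, rfl⟩ : ∃ j, k = j + 1 := ⟨k - 1, by omega⟩
  -- Since `p ≤ 1`, the range above the threshold is empty unless `(d^8)^N ≤ M`. This forces `n / k`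
  -- to be exponentially large in `k`, which makes the gain for small `l` effective.
  have hdk : d ^ (j + 1) ≤ √(3 * n / (j + 1 : ℕ)) := by
    have h1 : (d ^ 8) ^ (j + 1).choose 2 ≤ n.choose (j + 1) := by
      have h2 : (d ^ 8 * cliqueThreshold n (j + 1)) ^ (j + 1).choose 2 ≤ 1 :=
        pow_le_one₀ (by positivity) (hp.trans p.2.2)
      rw [mul_pow] at h2
      have h3 := choose_mul_cliqueThreshold_pow hk hkn
      have h4 := pow_pos hc ((j + 1).choose 2)
      nlinarith
    have h5 : (d ^ 8) ^ (j + 1).choose 2 = (d ^ (4 * j)) ^ (j + 1) := by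
      rw [← pow_mul, ← pow_mul]
      congr 1
      linarith [two_mul_choose_two j]
    have hu := one_le_three_mul_div hk hkn
    have h6 : d ^ (4 * j) ≤ 3 * n / (j + 1 : ℕ) :=
      le_of_pow_le_pow_left₀ (Nat.succ_ne_zero j) (by linarith)
        (h5 ▸ h1.trans (choose_le_three_mul_div_pow (by omega)))
    refine Real.le_sqrt_of_sq_le (le_trans ?_ h6)
    rw [← pow_mul]
    exact pow_le_pow_right₀ hd.le (by omega)
  refine (expectedOverlap_le hkn hp0).trans ?_
  refine mul_le_mul_of_nonneg_left (sum_range_interWeight_mul_le fun l hl => ?_) (by norm_num)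
  split_ifs with h2l
  · have h1 : ((p : ℝ) ^ l.choose 2)⁻¹
        ≤ ((d ^ 8) ^ l.choose 2)⁻¹ * (cliqueThreshold n (j + 1) ^ l.choose 2)⁻¹ := by
      rw [← mul_inv, ← mul_pow]
      exact inv_anti₀ (by positivity) (pow_le_pow_left₀ (by positivity) hp _)
    have h3 : interWeight n (j + 1) l * (1 * ((p : ℝ) ^ l.choose 2)⁻¹)
        ≤ ((d ^ 8) ^ l.choose 2)⁻¹ *
          (interWeight n (j + 1) l * (cliqueThreshold n (j + 1) ^ l.choose 2)⁻¹) := by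
      rw [one_mul]
      refine (mul_le_mul_of_nonneg_left h1 (interWeight_nonneg _ _ _)).trans_eq ?_
      ring
    refine h3.trans ?_
    rcases le_or_gt (2 * l) (j + 1 + 1) with hl2 | hl2
    · have h4 := interWeight_mul_inv_cliqueThreshold_pow_le_of_small hk hkn hl2
      have h5 : 3 * ((j + 1 : ℕ) : ℝ) ^ 2 / √(3 * n / (j + 1 : ℕ))
          ≤ 12 * ((j + 1 : ℕ) : ℝ) ^ 2 / d ^ (j + 1) := by
        refine div_le_div₀ (by positivity) ?_ (by positivity) hdk
        nlinarith
      have h6 : 0 ≤ 3 * ((j + 1 : ℕ) : ℝ) ^ 2 / √(3 * n / (j + 1 : ℕ)) := by positivity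
      have h7 : ((d ^ 8) ^ l.choose 2)⁻¹ ≤ 1 :=
        inv_le_one_of_one_le₀ (one_le_pow₀ (one_le_pow₀ hd.le))
      calc _ ≤ 1 * (3 * ((j + 1 : ℕ) : ℝ) ^ 2 / √(3 * n / (j + 1 : ℕ))) ^ l :=
            mul_le_mul h7 h4 (mul_nonneg (interWeight_nonneg _ _ _)
              (inv_nonneg.2 (pow_nonneg hc.le _))) zero_le_one
        _ ≤ 3 * ((j + 1 : ℕ) : ℝ) ^ 2 / √(3 * n / (j + 1 : ℕ)) := by
            rw [one_mul]
            exact pow_le_of_le_one h6 (h5.trans hsmall) (by omega)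
        _ ≤ _ := h5
    · have h4 := interWeight_mul_inv_cliqueThreshold_pow_le hk hkn hl
      obtain ⟨i, rfl⟩ : ∃ i, l = i + 1 := ⟨l - 1, by omega⟩
      -- For `2l ≥ k + 2` one has `8 C(l,2) = 4 l (l-1) ≥ k²`; the exponent 8 of `d` is chosen for
      -- this.
      have h5 : (d ^ (j + 1)) ^ (j + 1) ≤ (d ^ 8) ^ (i + 1).choose 2 := by
        rw [← pow_mul, ← pow_mul]
        refine pow_le_pow_right₀ hd.le ?_
        have := two_mul_choose_two i
        nlinarith
      have h6 : 12 / d ^ (j + 1) ≤ 12 * ((j + 1 : ℕ) : ℝ) ^ 2 / d ^ (j + 1) := by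
        refine div_le_div_of_nonneg_right ?_ (by positivity)
        nlinarith
      calc _ ≤ ((d ^ (j + 1)) ^ (j + 1))⁻¹ * 12 ^ (j + 1) :=
            mul_le_mul (inv_anti₀ (by positivity) h5) h4 (mul_nonneg (interWeight_nonneg _ _ _)
              (inv_nonneg.2 (pow_nonneg hc.le _))) (by positivity)
        _ = (12 / d ^ (j + 1)) ^ (j + 1) := by rw [div_pow, inv_mul_eq_div]
        _ ≤ 12 / d ^ (j + 1) :=
            pow_le_of_le_one (by positivity) (h6.trans hsmall) (Nat.succ_ne_zero j)
        _ ≤ _ := h6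
  · rw [zero_mul, mul_zero]
    positivity

/-- Below the threshold the expected overlap is close to one. -/
theorem one_sub_expectedOverlap_le_of_le_threshold (hk : 2 ≤ k) (hkn : k ≤ n) {q δ : ℝ}
    (hq1 : q < 1) (hδ : 0 ≤ δ) {p : unitInterval} (hp0 : 0 < (p : ℝ))
    (hp : p ≤ q * cliqueThreshold n k)
    (hsmall : 12 * (q ^ (δ / 2)) ^ (k - 1) ≤ 1) :
    1 - expectedOverlap k n p ≤ δ + (k + 1) * (12 * (q ^ (δ / 2)) ^ (k - 1)) := by
  have hc := cliqueThreshold_pos hkn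
  have hq0 : 0 < q := pos_of_mul_pos_left (hp0.trans_le hp) hc.le
  refine (one_sub_expectedOverlap_le hk hkn hp0 hδ).trans (add_le_add_right ?_ δ)
  set x : ℝ := p / cliqueThreshold n k with hx
  have hx0 : 0 < x := div_pos hp0 hc
  have hxq : x ≤ q := (div_le_iff₀ hc).2 hp
  have hpx : (p : ℝ) = x * cliqueThreshold n k := by
    rw [hx, div_mul_cancel₀ _ hc.ne']
  have hm : (n.choose k : ℝ) * (p : ℝ) ^ k.choose 2 = x ^ k.choose 2 := by
    rw [hpx, mul_pow, mul_left_comm, choose_mul_cliqueThreshold_pow hk hkn, mul_one]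
  rw [hm, Finset.mul_sum, Finset.sum_congr rfl fun l _ =>
    mul_left_comm (x ^ k.choose 2) (interWeight n k l) _]
  refine sum_range_interWeight_mul_le fun l hl => ?_
  have hs : 0 < q ^ (δ / 2) := Real.rpow_pos_of_pos hq0 _
  split_ifs with h
  · have hCN : l.choose 2 ≤ k.choose 2 := Nat.choose_le_choose 2 hl
    have h1 : x ^ k.choose 2 * (1 * ((p : ℝ) ^ l.choose 2)⁻¹)
        = x ^ (k.choose 2 - l.choose 2) * (cliqueThreshold n k ^ l.choose 2)⁻¹ := by
      rw [one_mul, hpx, mul_pow, mul_inv, ← mul_assoc, pow_sub₀ _ hx0.ne' hCN]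
    -- The exponent `N - C(l,2)` exceeds `δ N = (δ/2) (k-1) k`.
    have h2 : x ^ (k.choose 2 - l.choose 2) ≤ ((q ^ (δ / 2)) ^ (k - 1)) ^ k := by
      refine (pow_le_pow_left₀ hx0.le hxq _).trans ?_
      rw [← pow_mul, ← Real.rpow_natCast, ← Real.rpow_mul_natCast hq0.le]
      refine Real.rpow_le_rpow_of_exponent_ge hq0 hq1.le ?_
      rw [Nat.cast_sub hCN, Nat.cast_mul, Nat.cast_sub (by omega : 1 ≤ k)]
      rw [Nat.cast_choose_two ℝ k] at h ⊢
      push_cast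
      nlinarith
    have h3 := interWeight_mul_inv_cliqueThreshold_pow_le hk hkn hl
    calc _ = x ^ (k.choose 2 - l.choose 2) *
          (interWeight n k l * (cliqueThreshold n k ^ l.choose 2)⁻¹) := by rw [h1]; ring
      _ ≤ ((q ^ (δ / 2)) ^ (k - 1)) ^ k * 12 ^ k :=
          mul_le_mul h2 h3 (mul_nonneg (interWeight_nonneg _ _ _)
            (inv_nonneg.2 (pow_nonneg hc.le _))) (by positivity)
      _ = (12 * (q ^ (δ / 2)) ^ (k - 1)) ^ k := by rw [mul_pow, mul_comm]
      _ ≤ _ := pow_le_of_le_one (by positivity) hsmall (by omega)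
  · rw [zero_mul, mul_zero, mul_zero]
    positivity

/-- Here `m = 8^N`, and the second moment series is at most its value at the threshold. The bound
depends on `k` only. -/
theorem le_expectedOverlap_of_eq_eight_mul (hk : 2 ≤ k) (hkn : k ≤ n) {p : unitInterval}
    (hp : (p : ℝ) = 8 * cliqueThreshold n k) :
    1 / (8 ^ k.choose 2 * ((k + 1) * 12 ^ k)) ≤ expectedOverlap k n p := by
  have hc := cliqueThreshold_pos hkn
  refine le_expectedOverlap hk hkn (by rw [hp]; positivity) (by positivity) ?_
  rw [hp, mul_pow, mul_left_comm, choose_mul_cliqueThreshold_pow hk hkn, mul_one]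
  refine mul_le_mul_of_nonneg_left (sum_range_interWeight_mul_le fun l hl => ?_) (by positivity)
  refine le_trans (mul_le_mul_of_nonneg_left ?_ (interWeight_nonneg _ _ _))
    (interWeight_mul_inv_cliqueThreshold_pow_le hk hkn hl)
  refine inv_anti₀ (by positivity) (pow_le_pow_left₀ hc.le (by linarith) _)

theorem le_one_sub_expectedOverlap_of_eq_two_mul (hk : 2 ≤ k) (hkn : k ≤ n) {p : unitInterval}
    (hp : (p : ℝ) = 2 * cliqueThreshold n k) :
    1 / (2 * (k.choose 2 : ℝ)) ≤ 1 - expectedOverlap k n p := by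
  have hc := cliqueThreshold_pos hkn
  have hN : (0 : ℝ) < k.choose 2 := by exact_mod_cast Nat.choose_pos hk
  refine le_trans ?_ (le_one_sub_expectedOverlap hk hkn (by rw [hp]; positivity))
  rw [hp, mul_pow, mul_left_comm, choose_mul_cliqueThreshold_pow hk hkn, mul_one]
  have h2 : (2 : ℝ) ≤ 2 ^ k.choose 2 := le_self_pow₀ one_le_two (Nat.choose_pos hk).ne'
  have h3 : 1 / (2 : ℝ) ^ k.choose 2 ≤ 1 / 2 := one_div_le_one_div_of_le two_pos h2
  calc 1 / (2 * (k.choose 2 : ℝ)) = 1 / (k.choose 2 : ℝ) * (1 / 2) := by field_simp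
    _ ≤ _ := mul_le_mul_of_nonneg_left (by linarith) (by positivity)

end Bounds

/-! ### The transition for growing cliques and its failure for bounded ones -/

theorem normalizedMMSE_nonneg {v : ℕ} (H : SimpleGraph (Fin v)) (n : ℕ) (p : unitInterval) :
    0 ≤ normalizedMMSE H n p :=
  div_nonneg (integral_nonneg fun _ => Finset.sum_nonneg fun _ _ => sq_nonneg _)
    (Nat.cast_nonneg _)

theorem exhibitsAoN_top {k : ℕ → ℕ} (hkn : ∀ᶠ n in atTop, k n ≤ n) (hk : Tendsto k atTop atTop) :
    ExhibitsAoN (fun n => (⊤ : SimpleGraph (Fin (k n)))) (fun n => cliqueThreshold n (k n)) := by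
  intro ε hε δ hδ
  have habove : ∀ᶠ n in atTop, ∀ p : unitInterval, (1 + ε) * cliqueThreshold n (k n) ≤ p →
      |normalizedMMSE (⊤ : SimpleGraph (Fin (k n))) n p - 1| < δ := by
    obtain ⟨d, hd, hdε⟩ : ∃ d : ℝ, 1 < d ∧ d ^ 8 = 1 + ε := by
      refine ⟨(1 + ε) ^ ((8 : ℕ) : ℝ)⁻¹, Real.one_lt_rpow (by linarith) (by positivity), ?_⟩
      exact Real.rpow_inv_natCast_pow (by linarith) (by norm_num)
    have h2 : Tendsto (fun j : ℕ => 12 * (j : ℝ) ^ 2 / d ^ j) atTop (nhds 0) := by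
      have := (tendsto_pow_const_div_const_pow_of_one_lt 2 hd).const_mul 12
      simpa [mul_div_assoc] using this
    have h3 : Tendsto (fun j : ℕ => 4 * (((j : ℝ) + 1) * (12 * (j : ℝ) ^ 2 / d ^ j)))
        atTop (nhds 0) := by
      have := ((tendsto_pow_const_div_const_pow_of_one_lt 3 hd).add
        (tendsto_pow_const_div_const_pow_of_one_lt 2 hd)).const_mul 48
      simp only [add_zero, mul_zero] at this
      refine this.congr fun j => ?_
      ring
    filter_upwards [hkn, hk.eventually (eventually_ge_atTop 2),
      hk.eventually (h2.eventually_lt_const one_pos), hk.eventually (h3.eventually_lt_const hδ)]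
      with n hn hk2 hs1 hs2 p hp
    have hp0 : 0 < (p : ℝ) :=
      lt_of_lt_of_le (mul_pos (by linarith) (cliqueThreshold_pos hn)) hp
    rw [normalizedMMSE_eq hk2 hn hp0, sub_sub_cancel_left, abs_neg,
      abs_of_nonneg (expectedOverlap_nonneg _ _ _)]
    exact (expectedOverlap_le_of_threshold_le hk2 hn hd (hdε ▸ hp) hs1.le).trans_lt hs2
  have hbelow : ∀ᶠ n in atTop, ∀ p : unitInterval, (p : ℝ) ≤ (1 - ε) * cliqueThreshold n (k n) →
      |normalizedMMSE (⊤ : SimpleGraph (Fin (k n))) n p| < δ := by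
    rcases le_or_gt 1 ε with h1 | h1
    -- For `ε ≥ 1` the range below the threshold contains at most `p = 0`.
    · filter_upwards [hkn, hk.eventually (eventually_ge_atTop 2)] with n hn hk2 p hp
      have hp0 : (p : ℝ) = 0 := le_antisymm (hp.trans (mul_nonpos_of_nonpos_of_nonneg
        (by linarith) (cliqueThreshold_pos hn).le)) p.2.1
      rwa [normalizedMMSE_zero hk2 hn hp0, abs_zero]
    -- Half of the tolerance is spent on the overlap slack, so the rate is `(1 - ε)^((δ/2)/2)`.
    · set s : ℝ := (1 - ε) ^ (δ / 2 / 2) with hs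
      have hs0 : 0 < s := Real.rpow_pos_of_pos (by linarith) _
      have hs1 : s < 1 := Real.rpow_lt_one (by linarith) (by linarith) (by positivity)
      have h2 : Tendsto (fun j : ℕ => 12 * s ^ (j - 1)) atTop (nhds 0) := by
        have := ((tendsto_pow_atTop_nhds_zero_of_lt_one hs0.le hs1).comp
          (tendsto_sub_atTop_nat 1)).const_mul 12
        simpa using this
      have h3 : Tendsto (fun j : ℕ => ((j : ℝ) + 1) * (12 * s ^ (j - 1))) atTop (nhds 0) := by
        have := ((tendsto_self_mul_const_pow_of_lt_one hs0.le hs1).add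
          (tendsto_pow_atTop_nhds_zero_of_lt_one hs0.le hs1)).const_mul (12 / s)
        simp only [add_zero, mul_zero] at this
        refine this.congr' ?_
        filter_upwards [eventually_ge_atTop 1] with j hj
        obtain ⟨i, rfl⟩ : ∃ i, j = i + 1 := ⟨j - 1, by omega⟩
        rw [Nat.add_sub_cancel]
        field_simp
        ring
      filter_upwards [hkn, hk.eventually (eventually_ge_atTop 2),
        hk.eventually (h2.eventually_lt_const one_pos),
        hk.eventually (h3.eventually_lt_const (half_pos hδ))] with n hn hk2 hs2 hs3 p hp
      rcases p.2.1.eq_or_lt with hp0 | hp0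
      · rwa [normalizedMMSE_zero hk2 hn hp0.symm, abs_zero]
      · rw [abs_of_nonneg (normalizedMMSE_nonneg _ _ _), normalizedMMSE_eq hk2 hn hp0]
        have := one_sub_expectedOverlap_le_of_le_threshold hk2 hn (by linarith : 1 - ε < 1)
          (half_pos hδ).le hp0 hp hs2.le
        linarith
  filter_upwards [habove, hbelow] with n h1 h2 p
  exact ⟨h1 p, h2 p⟩

theorem eight_mul_cliqueThreshold_le_one {n k : ℕ} (hk : 2 ≤ k) (hn : k * 8 ^ k.choose 2 ≤ n) :
    8 * cliqueThreshold n k ≤ 1 := by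
  have hk0 : (0 : ℝ) < k := by exact_mod_cast (by omega : 0 < k)
  have h8 : (1 : ℝ) ≤ 8 ^ k.choose 2 := one_le_pow₀ (by norm_num)
  have hkn : k ≤ n := (Nat.le_mul_of_pos_right k (by positivity)).trans hn
  have hc := cliqueThreshold_pos hkn
  have hn' : (8 : ℝ) ^ k.choose 2 * k ≤ n := by
    rw [mul_comm]
    exact_mod_cast hn
  -- `8 * cliqueThreshold n k ≤ 1` amounts to `8^N ≤ M`, and `M ≥ (n/k)^k`.
  have h1 : (8 : ℝ) ^ k.choose 2 ≤ n.choose k := by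
    have h2 := pow_le_choose_mul_pow (le_refl k) hkn
    rw [← div_le_iff₀ (by positivity), ← div_pow] at h2
    have h3 : (8 : ℝ) ^ k.choose 2 ≤ n / k := (le_div_iff₀ hk0).2 hn'
    exact (h3.trans (le_self_pow₀ (h8.trans h3) (by omega))).trans h2
  refine le_of_pow_le_pow_left₀ (Nat.choose_pos hk).ne' zero_le_one ?_
  rw [one_pow, mul_pow, ← choose_mul_cliqueThreshold_pow hk hkn]
  exact mul_le_mul_of_nonneg_right h1 (pow_nonneg hc.le _)

theorem exists_frequently_eq_of_eventually_le {k : ℕ → ℕ} {C : ℕ} (h : ∀ᶠ n in atTop, k n ≤ C) :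
    ∃ r, ∃ᶠ n in atTop, k n = r := by
  by_contra! hr
  have hall : ∀ᶠ n in atTop, ∀ r ∈ Set.Iic C, k n ≠ r :=
    (eventually_all_finite (Set.finite_Iic C)).2 fun r _ => hr r
  obtain ⟨n, h1, h2⟩ := (h.and hall).exists
  exact h2 (k n) h1 rfl

/-- A bounded sequence takes some value `r` infinitely often, and along it the lower bounds at 2 and
8 times the threshold are constants. A critical value at most 4 times the threshold would force MMSE
near 1 at the point 8 (with `ε = 1`); a larger one would force MMSE near 0 at the point 2 (with `ε =
1/2`). -/
theorem not_exhibitsAoN_top {k : ℕ → ℕ} (hk2 : ∀ᶠ n in atTop, 2 ≤ k n) {C : ℕ}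
    (hC : ∀ᶠ n in atTop, k n ≤ C) (pc : ℕ → ℝ) :
    ¬ ExhibitsAoN (fun n => (⊤ : SimpleGraph (Fin (k n)))) pc := by
  intro hAoN
  obtain ⟨r, hr⟩ := exists_frequently_eq_of_eventually_le hC
  have hr2 : 2 ≤ r := by
    obtain ⟨n, h1, h2⟩ := (hr.and_eventually hk2).exists
    exact h1 ▸ h2
  have hN : (0 : ℝ) < r.choose 2 := by exact_mod_cast Nat.choose_pos hr2
  have habove := hAoN 1 one_pos (1 / (8 ^ r.choose 2 * ((r + 1) * 12 ^ r))) (by positivity)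
  have hbelow := hAoN (1 / 2) one_half_pos (1 / (2 * (r.choose 2 : ℝ))) (by positivity)
  obtain ⟨n, rfl, hn, hab, hbe⟩ := (hr.and_eventually ((eventually_ge_atTop
    (r * 8 ^ r.choose 2)).and (habove.and hbelow))).exists
  have hrn : k n ≤ n := (Nat.le_mul_of_pos_right (k n) (by positivity)).trans hn
  have hc := cliqueThreshold_pos hrn
  have h8 := eight_mul_cliqueThreshold_le_one hr2 hn
  rcases le_or_gt (pc n) (4 * cliqueThreshold n (k n)) with h | h
  · obtain ⟨p, hp⟩ : ∃ p : unitInterval, (p : ℝ) = 8 * cliqueThreshold n (k n) :=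
      ⟨⟨_, by positivity, h8⟩, rfl⟩
    have h1 := (hab p).1 (by rw [hp]; linarith)
    rw [normalizedMMSE_eq hr2 hrn (by rw [hp]; positivity),
      sub_sub_cancel_left, abs_neg, abs_of_nonneg (expectedOverlap_nonneg _ _ _)] at h1
    exact h1.not_ge (le_expectedOverlap_of_eq_eight_mul hr2 hrn hp)
  · obtain ⟨p, hp⟩ : ∃ p : unitInterval, (p : ℝ) = 2 * cliqueThreshold n (k n) :=
      ⟨⟨_, by positivity, by linarith⟩, rfl⟩
    have h1 := (hbe p).2 (by rw [hp]; linarith)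
    rw [abs_of_nonneg (normalizedMMSE_nonneg _ _ _),
      normalizedMMSE_eq hr2 hrn (by rw [hp]; positivity)] at h1
    exact h1.not_ge (le_one_sub_expectedOverlap_of_eq_two_mul hr2 hrn hp)

theorem corollaryc (k : ℕ → ℕ)
    (hk2 : ∀ᶠ n in atTop, 2 ≤ k n) (hkn : ∀ᶠ n in atTop, k n ≤ n) :
    (Tendsto k atTop atTop →
      (∀ᶠ n in atTop, firstMomentThreshold (⊤ : SimpleGraph (Fin (k n))) n =
        (n.choose (k n) : ℝ) ^ (-(1 : ℝ) / ((k n).choose 2 : ℝ))) ∧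
      ExhibitsAoN (fun n => (⊤ : SimpleGraph (Fin (k n))))
        (fun n => (n.choose (k n) : ℝ) ^ (-(1 : ℝ) / ((k n).choose 2 : ℝ)))) ∧
    ((∃ C : ℕ, ∀ᶠ n in atTop, k n ≤ C) →
      ∀ pc : ℕ → ℝ, ¬ ExhibitsAoN (fun n => (⊤ : SimpleGraph (Fin (k n)))) pc) := by
  refine ⟨fun hk => ⟨?_, exhibitsAoN_top hkn hk⟩, fun ⟨C, hC⟩ => not_exhibitsAoN_top hk2 hC⟩
  filter_upwards [hk2, hkn] with n h2 hn
  exact firstMomentThreshold_top h2 hn
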